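/- **Setting.** Let $E=(E^0,E^1,r,s)$ be a directed graph which is row-finite and has no sources, i.e. $0<|r^{-1}(v)|<\infty$ for every vertex $v$, and let $R$ be an integral domain with identity and with an involution $r\mapsto\overline r$ (a ring automorphism of period at most $2$). Paths satisfy $s(\mu_i)=r(\mu_{i+1})$; vertices are the paths of length $0$; $P(E)$ is the set of finite paths and $E^\infty$ the set of infinite paths, with the topology with basis the sets $Z(\mu)=\{\mu z: z\in E^\infty,\ r(z)=s(\mu)\}$, $\mu\in P(E)$. The graph groupoid is $$G_E=\{(x,k,y)\in E^\infty\times\mathbb Z\times E^\infty:\ \exists N\ \forall i\ge N\ \ x_{i+k}=y_i\},$$ with range $x$, source $y$ (where $x\in E^\infty$ is identified with the unit $(x,0,x)$), product $(x,k,y)(y,l,z)=(x,k+l,z)$, inverse $(x,k,y)^{-1}=(y,-k,x)$, and the topology with basis the sets $Z(\mu,\nu)=\{(\mu z,|\mu|-|\nu|,\nu z): z\in E^\infty,\ r(z)=s(\mu)\}$ for $\mu,\nu\in P(E)$ with $s(\mu)=s(\nu)$. The Leavitt path algebra is $L_R(E)=\operatorname{span}_R\{\mathbf 1_{Z(\mu,\nu)}: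 s(\mu)=s(\nu)\}$, an algebra of functions $G_E\to R$ with $fg(\gamma)=\sum_{r(\eta)=r(\gamma)}f(\eta)g(\eta^{-1}\gamma)$ and $f^*(\gamma)=\overline{f(\gamma^{-1})}$; it is $\mathbb Z$-graded, $f$ being homogeneous of degree $k$ if it is supported on $\{(x,l,y): l=k\}$. Its diagonal is $D(E)=\operatorname{span}_R\{\mathbf 1_{Z(\mu,\mu)}:\mu\in P(E)\}$, and the set of normalizers is $N(E)=\{n\in L_R(E): ndn^*,\ n^*dn\in D(E)\text{ for all }d\in D(E)\}$. For $n\in N(E)$ put $\operatorname{dom}(n)=\{x\in E^\infty:(n^*n)(x,0,x)\ne0\}$, and for $x\in\operatorname{dom}(n)$ let $\alpha_n(x)$ be the element of the set $\{r(g): n(g)\neq0,\ s(g)=x\}$. If $x\in E^\infty$ is an isolated point, let $p_x=\mathbf 1_{\{(x,0,x)\}}$. On $\{(n,x): n\in N(E),\ x\in\operatorname{dom}(n)\}$ let $(n,x)\sim(m,x')$ mean that $x=x'$ and that either (i) $x$ is isolated, $\alpha_n(x)=\alpha_m(x)$ and $p_xn^*mp_x$ has degree $0$; or (ii) $x$ is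 not isolated and there is an open neighbourhood $V\subseteq\operatorname{dom}(n)\cap\operatorname{dom}(m)$ of $x$ with $\alpha_n=\alpha_m$ on $V$. Let $W_E$ be the set of classes $[(n,x)]$, and for $n\in N(E)$ let $Z(n)=\{[(n,x)]: x\in\operatorname{dom}(n)\}$. **Theorem.** For all $n\in N(E)$ and $x\in\operatorname{dom}(n)$ the set $\{r(g): n(g)\ne0,\ s(g)=x\}$ is a singleton, so that $\alpha_n(x)$ is well defined, and $\sim$ is an equivalence relation. The set $W_E$ is a groupoid under the well-defined operations given as follows: $[(n_1,x_1)]$ and $[(n_2,x_2)]$ are composable if and only if $\alpha_{n_2}(x_2)=x_1$, and then $[(n_1,x_1)][(n_2,x_2)]=[(n_1n_2,x_2)]$; the range, the source and the inverse of $[(n,x)]$ are $[(nn^*,\alpha_n(x))]$, $[(n^*n,x)]$ and $[(n^*,\alpha_n(x))]$; the unit space is $\{[(d,x)]: d\in D(E),\ x\in\operatorname{dom}(d)\}$. The map $$\Phi:G_E\to W_E,\qquad (\mu x,|\mu|-|\nu|,\nu x)\mapsto[(\mathbf 1_{Z(\mu,\nu)},\nu x)]$$ for $\mu,\nu\in P(E)$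 and $x\in E^\infty$ with $s(\mu)=s(\nu)=r(x)$, is a well-defined isomorphism of groupoids. The sets $Z(n)$, $n\in N(E)$, form a basis for a topology on $W_E$. With this topology $W_E$ is a topological groupoid (composition and inversion are continuous), and $\Phi$ is a homeomorphism; in particular $W_E$ and $G_E$ are isomorphic as topological groupoids. -/

import Mathlib

open Set TopologicalSpace

noncomputable section

namespace GraphWeyl

universe u v w

/-! ## Groupoids given by their set of arrows -/

/-- A groupoid presented by its set `G` of arrows: every object is identified with its identity
arrow, `rng` and `src` send an arrow to (the identity arrow at) its range and source, and
`mul a b` is defined exactly when `src a = rng b`. -/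
structure GroupoidStr (G : Type u) where
  rng : G → G
  src : G → G
  inv : G → G
  mul : (a b : G) → src a = rng b → G
  rng_rng : ∀ a, rng (rng a) = rng a
  src_rng : ∀ a, src (rng a) = rng a
  rng_src : ∀ a, rng (src a) = src a
  src_src : ∀ a, src (src a) = src a
  rng_mul : ∀ a b h, rng (mul a b h) = rng a
  src_mul : ∀ a b h, src (mul a b h) = src b
  mul_assoc : ∀ a b c (h₁ : src a = rng b) (h₂ : src b = rng c),
    mul (mul a b h₁) c ((src_mul a b h₁).trans h₂) =
      mul a (mul b c h₂) (h₁.trans (rng_mul b c h₂).symm)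
  rng_mul_self : ∀ a, mul (rng a) a (src_rng a) = a
  mul_src_self : ∀ a, mul a (src a) (rng_src a).symm = a
  rng_inv : ∀ a, rng (inv a) = src a
  src_inv : ∀ a, src (inv a) = rng a
  mul_inv : ∀ a, mul a (inv a) (rng_inv a).symm = rng a
  inv_mul : ∀ a, mul (inv a) a (src_inv a) = src a

/-- The unit space, as a subset of the set of arrows. -/
def GroupoidStr.units {G : Type u} (S : GroupoidStr G) : Set G := {a | S.rng a = a}

/-- The groupoid is topological: composition (on the set of composable pairs, with the relative
product topology) and inversion are continuous. -/
def GroupoidStr.IsTopological {G : Type u} [TopologicalSpace G] (S : GroupoidStr G) : Prop :=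
  Continuous (fun p : {p : G × G // S.src p.1 = S.rng p.2} => S.mul p.1.1 p.1.2 p.2) ∧
    Continuous S.inv

/-- An isomorphism of groupoids: a bijection between the arrows which respects range and source
(hence composability), products and inverses. -/
structure GroupoidIso {G : Type u} {H : Type v} (S : GroupoidStr G) (T : GroupoidStr H)
    extends G ≃ H where
  map_rng : ∀ a, toFun (S.rng a) = T.rng (toFun a)
  map_src : ∀ a, toFun (S.src a) = T.src (toFun a)
  map_inv : ∀ a, toFun (S.inv a) = T.inv (toFun a)
  map_mul : ∀ a b (h : S.src a = S.rng b),
    toFun (S.mul a b h) =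
      T.mul (toFun a) (toFun b) ((map_src a).symm.trans ((congrArg toFun h).trans (map_rng b)))

/-! ## Directed graphs and their paths -/

/-- A directed graph with vertex set `V`, edge set `E`, range map `r` and source map `s`. -/
structure DirectedGraph (V : Type u) (E : Type v) where
  r : E → V
  s : E → V

section Paths

variable {V : Type u} {E : Type v} (Γ : DirectedGraph V E)

/-- Every vertex is the range of finitely many edges only. -/
def RowFinite : Prop := ∀ v : V, {e : E | Γ.r e = v}.Finite

/-- Every vertex is the range of some edge. -/
def NoSources : Prop := ∀ v : V, ∃ e : E, Γ.r e = v

/-- `e₁ e₂ ⋯ eₙ` is a path with range `v`, i.e. `r e₁ = v` and `s eᵢ = r eᵢ₊₁`. -/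
def IsPathAt : V → List E → Prop
  | _, [] => True
  | v, e :: es => Γ.r e = v ∧ IsPathAt (Γ.s e) es

/-- The source of a path with range `v`. -/
def endVertex : V → List E → V
  | v, [] => v
  | _, e :: es => endVertex (Γ.s e) es

/-- Finite paths; the vertices are the paths with an empty list of edges. -/
structure FinPath where
  range : V
  edges : List E
  isPath : IsPathAt Γ range edges

/-- Infinite paths `x₁ x₂ ⋯`, with `s xᵢ = r xᵢ₊₁`; the edge `xᵢ₊₁` is `x.edge i`. -/
@[ext]
structure InfPath where
  edge : ℕ → E
  isPath : ∀ i, Γ.s (edge i) = Γ.r (edge (i + 1))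

variable {Γ}

/-- The source of a finite path. -/
def FinPath.source (μ : FinPath Γ) : V := endVertex Γ μ.range μ.edges

/-- The length of a finite path. -/
def FinPath.length (μ : FinPath Γ) : ℕ := μ.edges.length

/-- The range of an infinite path. -/
def InfPath.range (x : InfPath Γ) : V := Γ.r (x.edge 0)

/-- A list followed by an infinite sequence. -/
def appendSeq : List E → (ℕ → E) → ℕ → E
  | [], z => z
  | e :: es, z => fun i => Nat.casesOn i e (fun j => appendSeq es z j)

theorem appendSeq_add (es : List E) (z : ℕ → E) (i : ℕ) :
    appendSeq es z (es.length + i) = z i := by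
  induction es with
  | nil => simp [appendSeq]
  | cons e es ih =>
    have : (e :: es).length + i = (es.length + i) + 1 := by simp; omega
    rw [this]
    exact ih

theorem r_appendSeq_zero (es : List E) (z : ℕ → E) (v : V) (h : IsPathAt Γ v es)
    (hz : endVertex Γ v es = Γ.r (z 0)) : Γ.r (appendSeq es z 0) = v := by
  cases es with
  | nil => exact hz.symm
  | cons e es => exact h.1

theorem isPath_appendSeq (es : List E) (z : ℕ → E) (v : V) (h : IsPathAt Γ v es)
    (hz : endVertex Γ v es = Γ.r (z 0)) (hp : ∀ i, Γ.s (z i) = Γ.r (z (i + 1))) (i : ℕ) :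
    Γ.s (appendSeq es z i) = Γ.r (appendSeq es z (i + 1)) := by
  induction es generalizing v i with
  | nil => exact hp i
  | cons e es ih =>
    cases i with
    | zero => exact (r_appendSeq_zero es z (Γ.s e) h.2 hz).symm
    | succ j => exact ih (Γ.s e) h.2 hz j

/-- The infinite path `μ z`, defined when `s μ = r z`. -/
def concat (μ : FinPath Γ) (z : InfPath Γ) (h : μ.source = z.range) : InfPath Γ where
  edge := appendSeq μ.edges z.edge
  isPath := isPath_appendSeq μ.edges z.edge μ.range μ.isPath h z.isPath

/-- The cylinder set `Z(μ) = {μ z : z ∈ s(μ) E^∞}`. -/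
def cylinder (μ : FinPath Γ) : Set (InfPath Γ) :=
  {x | ∃ (z : InfPath Γ) (h : μ.source = z.range), x = concat μ z h}

/-- The topology on the infinite path space with basis the cylinder sets. -/
instance : TopologicalSpace (InfPath Γ) := generateFrom (Set.range cylinder)

/-- `x` is an isolated point of the infinite path space. -/
def IsIsolated (x : InfPath Γ) : Prop := IsOpen ({x} : Set (InfPath Γ))

/-- `x` and `y` are shift equivalent with lag `k`: `x_{i+k} = y_i` for all large `i`. -/
def ShiftEquiv (x : InfPath Γ) (k : ℤ) (y : InfPath Γ) : Prop :=
  ∃ a b : ℕ, (a : ℤ) - b = k ∧ ∀ i, x.edge (a + i) = y.edge (b + i)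

theorem ShiftEquiv.refl (x : InfPath Γ) : ShiftEquiv x 0 x := ⟨0, 0, by simp, fun _ => rfl⟩

theorem ShiftEquiv.symm {x y : InfPath Γ} {k : ℤ} (h : ShiftEquiv x k y) :
    ShiftEquiv y (-k) x := by
  obtain ⟨a, b, hk, h⟩ := h
  exact ⟨b, a, by omega, fun i => (h i).symm⟩

theorem ShiftEquiv.trans {x y z : InfPath Γ} {k l : ℤ} (h : ShiftEquiv x k y)
    (h' : ShiftEquiv y l z) : ShiftEquiv x (k + l) z := by
  obtain ⟨a, b, hk, h⟩ := h
  obtain ⟨c, d, hl, h'⟩ := h'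
  refine ⟨a + c, b + d, by push_cast; omega, fun i => ?_⟩
  rw [show a + c + i = a + (c + i) by omega, h, show b + (c + i) = c + (b + i) by omega, h',
    show d + (b + i) = b + d + i by omega]

/-! ## The graph groupoid -/

variable (Γ)

/-- The arrows `(x, k, y)` of the graph groupoid. -/
@[ext]
structure Arrow where
  left : InfPath Γ
  lag : ℤ
  right : InfPath Γ
  shift : ShiftEquiv left lag right

variable {Γ}

/-- The identity arrow `(x, 0, x)`. -/
def Arrow.unit (x : InfPath Γ) : Arrow Γ := ⟨x, 0, x, ShiftEquiv.refl x⟩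

/-- `(x, k, y)⁻¹ = (y, -k, x)`. -/
def Arrow.inv (g : Arrow Γ) : Arrow Γ := ⟨g.right, -g.lag, g.left, g.shift.symm⟩

/-- `(x, k, y) (y, l, z) = (x, k + l, z)`. -/
def Arrow.mul (g h : Arrow Γ) (e : g.right = h.left) : Arrow Γ :=
  ⟨g.left, g.lag + h.lag, h.right, g.shift.trans (e ▸ h.shift)⟩

theorem Arrow.unit_left_inj {x y : InfPath Γ} (h : Arrow.unit x = Arrow.unit y) : x = y :=
  congrArg Arrow.left h

variable (Γ)

/-- The graph groupoid. -/
def graphGroupoid : GroupoidStr (Arrow Γ) where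
  rng g := Arrow.unit g.left
  src g := Arrow.unit g.right
  inv g := g.inv
  mul g h e := g.mul h (Arrow.unit_left_inj e)
  rng_rng _ := rfl
  src_rng _ := rfl
  rng_src _ := rfl
  src_src _ := rfl
  rng_mul _ _ _ := rfl
  src_mul _ _ _ := rfl
  mul_assoc _ _ _ _ _ := Arrow.ext rfl (add_assoc _ _ _) rfl
  rng_mul_self _ := Arrow.ext rfl (zero_add _) rfl
  mul_src_self _ := Arrow.ext rfl (add_zero _) rfl
  rng_inv _ := rfl
  src_inv _ := rfl
  mul_inv _ := Arrow.ext rfl (add_neg_cancel _) rfl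
  inv_mul _ := Arrow.ext rfl (neg_add_cancel _) rfl

variable {Γ}

/-- The arrow `(μ z, |μ| - |ν|, ν z)`. -/
def arrowOf (μ ν : FinPath Γ) (z : InfPath Γ) (hμ : μ.source = z.range)
    (hν : ν.source = z.range) : Arrow Γ where
  left := concat μ z hμ
  lag := (μ.length : ℤ) - ν.length
  right := concat ν z hν
  shift := ⟨μ.length, ν.length, rfl, fun i =>
    (appendSeq_add μ.edges z.edge i).trans (appendSeq_add ν.edges z.edge i).symm⟩

/-- `Z(μ, ν) = {(μ z, |μ| - |ν|, ν z) : z ∈ s(μ) E^∞}`. -/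
def bicylinder (μ ν : FinPath Γ) : Set (Arrow Γ) :=
  {g | ∃ (z : InfPath Γ) (hμ : μ.source = z.range) (hν : ν.source = z.range),
    g = arrowOf μ ν z hμ hν}

/-- The topology on the graph groupoid with basis the sets `Z(μ, ν)`, `s μ = s ν`. -/
instance : TopologicalSpace (Arrow Γ) :=
  generateFrom {B | ∃ μ ν : FinPath Γ, μ.source = ν.source ∧ B = bicylinder μ ν}

end Paths

/-! ## The Leavitt path algebra as the Steinberg algebra of the graph groupoid -/

section Algebra

variable {V : Type u} {E : Type v} (Γ : DirectedGraph V E) (R : Type w) [CommRing R]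

variable {Γ}

/-- The characteristic function of a set of arrows. -/
def charFun (B : Set (Arrow Γ)) : Arrow Γ → R := B.indicator (fun _ => 1)

/-- The projection `p_x`, the characteristic function of `{(x, 0, x)}`. -/
def pointFun (x : InfPath Γ) : Arrow Γ → R := charFun R {Arrow.unit x}

variable (Γ)

/-- The underlying module of the Leavitt path algebra, inside the functions on the graph
groupoid. -/
def leavitt : Submodule R (Arrow Γ → R) :=
  Submodule.span R {f | ∃ μ ν : FinPath Γ, μ.source = ν.source ∧ f = charFun R (bicylinder μ ν)}

/-- The diagonal subalgebra. -/
def diagonal : Submodule R (Arrow Γ → R) :=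
  Submodule.span R {f | ∃ μ : FinPath Γ, f = charFun R (bicylinder μ μ)}

variable {Γ R}

/-- The convolution product `(f * g)(γ) = ∑_{r(η) = r(γ)} f(η) g(η⁻¹ γ)`; the sum has only
finitely many nonzero terms when `f` is in the Leavitt path algebra. -/
def conv (f g : Arrow Γ → R) : Arrow Γ → R := fun γ =>
  ∑ᶠ η : {η : Arrow Γ // η.left = γ.left}, f η.1 * g (η.1.inv.mul γ η.2)

/-- `f` is homogeneous of degree `k` for the `ℤ`-grading given by the lag. -/
def IsHomogeneousOfDegree (f : Arrow Γ → R) (k : ℤ) : Prop := ∀ g, f g ≠ 0 → g.lag = k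

/-- The set `r(supp(n) x)`. -/
def targets (n : Arrow Γ → R) (x : InfPath Γ) : Set (InfPath Γ) :=
  {y | ∃ g : Arrow Γ, n g ≠ 0 ∧ g.right = x ∧ g.left = y}

open Classical in
/-- The partial action `α_n`: for `x ∈ s(supp(n))`, `α_n(x)` is the element of `r(supp(n) x)`
(which is a singleton if `n` is a normalizer). It has the irrelevant value `x` outside
`s(supp(n))`. -/
def alpha (n : Arrow Γ → R) (x : InfPath Γ) : InfPath Γ :=
  if h : (targets n x).Nonempty then h.some else x

variable [StarRing R]

/-- The involution `f^*(γ) = \overline{f(γ⁻¹)}`. -/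
def adj (f : Arrow Γ → R) : Arrow Γ → R := fun γ => star (f γ.inv)

variable (Γ R) in
/-- The normalizers of the diagonal in the Leavitt path algebra. -/
def normalizers : Set (Arrow Γ → R) :=
  {n | n ∈ leavitt Γ R ∧ ∀ d ∈ diagonal Γ R,
    conv (conv n d) (adj n) ∈ diagonal Γ R ∧ conv (conv (adj n) d) n ∈ diagonal Γ R}

/-- `dom(n) = supp(n^* n)`, as a subset of the infinite path space. -/
def dom (n : Arrow Γ → R) : Set (InfPath Γ) := {x | conv (adj n) n (Arrow.unit x) ≠ 0}

/-! ## The algebraic Weyl groupoid -/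

variable (Γ R) in
/-- The pairs `(n, x)` with `n` a normalizer and `x ∈ dom(n)`. -/
structure WeylPair where
  n : Arrow Γ → R
  x : InfPath Γ
  mem_normalizers : n ∈ normalizers Γ R
  mem_dom : x ∈ dom n

/-- The relation `∼` on pairs: same point `x` and, if `x` is isolated, `α_n(x) = α_m(x)` and
`p_x n^* m p_x` has degree `0`; if `x` is not isolated, `α_n` and `α_m` agree near `x`. -/
def WeylRel (p q : WeylPair Γ R) : Prop :=
  p.x = q.x ∧
    ((IsIsolated p.x ∧ alpha p.n p.x = alpha q.n p.x ∧
        IsHomogeneousOfDegree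
          (conv (conv (conv (pointFun R p.x) (adj p.n)) q.n) (pointFun R p.x)) 0) ∨
      (¬ IsIsolated p.x ∧ ∃ U : Set (InfPath Γ), IsOpen U ∧ p.x ∈ U ∧ U ⊆ dom p.n ∩ dom q.n ∧
        ∀ y ∈ U, alpha p.n y = alpha q.n y))

variable (Γ R) in
/-- The arrows of the algebraic Weyl groupoid: the classes of pairs under `∼`. -/
def Weyl : Type (max v w) := Quot (WeylRel (Γ := Γ) (R := R))

/-- The class `[(n, x)]`. -/
def WeylPair.cls (p : WeylPair Γ R) : Weyl Γ R := Quot.mk _ p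

/-- `c = [(n, x)]`, which includes that `n` is a normalizer and that `x ∈ dom(n)`. -/
def IsClassOf (c : Weyl Γ R) (n : Arrow Γ → R) (x : InfPath Γ) : Prop :=
  ∃ p : WeylPair Γ R, p.n = n ∧ p.x = x ∧ c = p.cls

/-- The set `Z(n) = {[(n, x)] : x ∈ dom(n)}`. -/
def weylBasic (n : Arrow Γ → R) : Set (Weyl Γ R) := {c | ∃ x ∈ dom n, IsClassOf c n x}

variable (Γ R) in
/-- The family of all `Z(n)`, `n` a normalizer. -/
def weylBasis : Set (Set (Weyl Γ R)) := {B | ∃ n ∈ normalizers Γ R, B = weylBasic n}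

/-- The topology on the Weyl groupoid generated by the sets `Z(n)`. -/
instance : TopologicalSpace (Weyl Γ R) := generateFrom (weylBasis Γ R)

/-- The groupoid structure `S` on the set of classes is the one of the algebraic Weyl groupoid:
`[(n₁, x₁)]` and `[(n₂, x₂)]` are composable iff `α_{n₂}(x₂) = x₁`, with product
`[(n₁ n₂, x₂)]`; the range, source and inverse of `[(n, x)]` are `[(n n^*, α_n(x))]`,
`[(n^* n, x)]` and `[(n^*, α_n(x))]`; the units are the classes `[(d, x)]` with `d` in the
diagonal. These formulas hold for all representatives and determine `S`. -/
structure IsWeylStructure (S : GroupoidStr (Weyl Γ R)) : Prop where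
  composable : ∀ p q : WeylPair Γ R, S.src p.cls = S.rng q.cls ↔ alpha q.n q.x = p.x
  mul : ∀ (p q : WeylPair Γ R) (h : S.src p.cls = S.rng q.cls),
    IsClassOf (S.mul p.cls q.cls h) (conv p.n q.n) q.x
  rng : ∀ p : WeylPair Γ R, IsClassOf (S.rng p.cls) (conv p.n (adj p.n)) (alpha p.n p.x)
  src : ∀ p : WeylPair Γ R, IsClassOf (S.src p.cls) (conv (adj p.n) p.n) p.x
  inv : ∀ p : WeylPair Γ R, IsClassOf (S.inv p.cls) (adj p.n) (alpha p.n p.x)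
  units : S.units = {c | ∃ d ∈ diagonal Γ R, ∃ x ∈ dom d, IsClassOf c d x}

end Algebra

end GraphWeyl

end

open GraphWeyl

/-!
The proof identifies the normalizers. If `n` is a normalizer and `g`, `h` are arrows with the same
source `x` at which `n` does not vanish, replace `g` by the arrow of largest lag with its range and
source at which `n` does not vanish, and `h` by the one of smallest lag. For the characteristic
function `d` of a small enough cylinder at `x`, the convolution sum for the value of `n d n^*` at
`g h⁻¹` then has the single nonzero term `n(g) \overline{n(h)}`, as `R` is a domain. Since
`n d n^*` lives on the unit space, `g h⁻¹` is a unit, and the choice of the lags gives `g = h`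
(`injOn_right_support`). Applied to `n` and to `n^*`, this says that the support of a normalizer is
a bisection. Conversely, an element of the Leavitt path algebra whose support is a bisection is a
normalizer, because the diagonal consists of the elements supported on the unit space
(`mem_diagonal_iff`, `mem_normalizers_iff`).

Hence a pair `(n, x)` determines a single arrow `g` with source `x` and `n(g) ≠ 0`, and
`α_n(x) = r(g)`. Two pairs are equivalent exactly when their arrows are equal (`weylRel_iff`). Over
an isolated point, `p_x n^* m p_x` is supported at `g⁻¹ h`, so it has degree `0` if and only if the
lags of `g` and `h` agree. Over a point `x` that is not isolated, equal arrows give equal partial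
actions near `x` because supports are open; and if the partial actions agree near `x` but the lags
differ, then all paths near `x` are periodic from a fixed place on with a fixed period, which makes
`x` isolated (`isIsolated_of_lag_lt`).

So `[(n, x)] ↦ g` is a bijection from the Weyl groupoid to the graph groupoid (`weylEquiv`), which
carries `Z(n)` to the support of `n` and hence is a homeomorphism: supports are open, as elements
of the Leavitt path algebra are locally constant, and the sets `Z(μ, ν)` are supports of
normalizers. The groupoid structure is transported along this bijection, and the formulas for it
follow from `supp(m n) = supp(m) supp(n)` and `supp(n^*) = supp(n)⁻¹`.
-/

namespace GraphWeyl

/-! ### Initial segments and tails of infinite paths -/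

section Paths

universe u v

variable {V : Type u} {E : Type v} {Γ : DirectedGraph V E}

theorem FinPath.ext' {μ ν : FinPath Γ} (hr : μ.range = ν.range) (he : μ.edges = ν.edges) :
    μ = ν := by
  cases μ; cases ν; cases hr; cases he; rfl

theorem ofFn_appendSeq (es : List E) (z : ℕ → E) :
    List.ofFn (fun i : Fin es.length => appendSeq es z i) = es := by
  induction es with
  | nil => rfl
  | cons e es ih =>
    rw [List.length_cons, List.ofFn_succ]
    exact congrArg (e :: ·) ih

theorem appendSeq_ofFn (n : ℕ) (z : ℕ → E) :
    appendSeq (List.ofFn fun i : Fin n => z i) (fun i => z (n + i)) = z := by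
  induction n generalizing z with
  | zero => funext i; simp [appendSeq]
  | succ n ih =>
    rw [List.ofFn_succ]
    funext i
    cases i with
    | zero => rfl
    | succ j =>
      have := congrFun (ih fun i => z (i + 1)) j
      simp only [add_right_comm] at this ⊢
      exact this

theorem isPathAt_ofFn (n : ℕ) (z : ℕ → E) (hz : ∀ i, Γ.s (z i) = Γ.r (z (i + 1))) :
    IsPathAt Γ (Γ.r (z 0)) (List.ofFn fun i : Fin n => z i) := by
  induction n generalizing z with
  | zero => trivial
  | succ n ih =>
    rw [List.ofFn_succ]
    refine ⟨rfl, ?_⟩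
    have := ih (fun i => z (i + 1)) fun i => hz (i + 1)
    rw [← hz 0] at this
    exact this

theorem endVertex_ofFn (n : ℕ) (z : ℕ → E) (hz : ∀ i, Γ.s (z i) = Γ.r (z (i + 1))) :
    endVertex Γ (Γ.r (z 0)) (List.ofFn fun i : Fin n => z i) = Γ.r (z n) := by
  induction n generalizing z with
  | zero => rfl
  | succ n ih =>
    rw [List.ofFn_succ]
    have := ih (fun i => z (i + 1)) fun i => hz (i + 1)
    rw [← hz 0] at this
    exact this

/-- The initial segment of length `n` of an infinite path. -/
def InfPath.take (x : InfPath Γ) (n : ℕ) : FinPath Γ where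
  range := x.range
  edges := List.ofFn fun i : Fin n => x.edge i
  isPath := isPathAt_ofFn n x.edge x.isPath

/-- The infinite path that remains after the first `n` edges are removed. -/
def InfPath.drop (x : InfPath Γ) (n : ℕ) : InfPath Γ where
  edge i := x.edge (n + i)
  isPath i := x.isPath (n + i)

theorem InfPath.length_take (x : InfPath Γ) (n : ℕ) : (x.take n).length = n := by
  simp [FinPath.length, InfPath.take]

theorem InfPath.source_take (x : InfPath Γ) (n : ℕ) : (x.take n).source = (x.drop n).range :=
  endVertex_ofFn n x.edge x.isPath

theorem InfPath.concat_take_drop (x : InfPath Γ) (n : ℕ) :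
    concat (x.take n) (x.drop n) (x.source_take n) = x :=
  InfPath.ext (appendSeq_ofFn n x.edge)

theorem take_concat (μ : FinPath Γ) (z : InfPath Γ) (h : μ.source = z.range) :
    (concat μ z h).take μ.length = μ :=
  FinPath.ext' (r_appendSeq_zero μ.edges z.edge μ.range μ.isPath h)
    (ofFn_appendSeq μ.edges z.edge)

theorem drop_concat (μ : FinPath Γ) (z : InfPath Γ) (h : μ.source = z.range) :
    (concat μ z h).drop μ.length = z :=
  InfPath.ext (funext (appendSeq_add μ.edges z.edge))

theorem mem_cylinder_iff {μ : FinPath Γ} {x : InfPath Γ} :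
    x ∈ cylinder μ ↔ x.take μ.length = μ := by
  constructor
  · rintro ⟨z, h, rfl⟩
    exact take_concat μ z h
  · intro h
    refine ⟨x.drop μ.length, ?_, ?_⟩
    · conv_lhs => rw [← h]
      exact x.source_take _
    · refine InfPath.ext ?_
      change _ = appendSeq μ.edges _
      rw [← congrArg FinPath.edges h]
      exact (appendSeq_ofFn μ.length x.edge).symm

theorem take_eq_take_iff {x y : InfPath Γ} {n : ℕ} :
    x.take n = y.take n ↔ x.range = y.range ∧ ∀ i < n, x.edge i = y.edge i := by
  constructor
  · intro h
    refine ⟨congrArg FinPath.range h, fun i hi => ?_⟩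
    exact congrFun (List.ofFn_injective (congrArg FinPath.edges h)) ⟨i, hi⟩
  · rintro ⟨h₁, h₂⟩
    exact FinPath.ext' h₁ (congrArg List.ofFn (funext fun i : Fin n => h₂ i i.2))

theorem take_eq_of_le {x y : InfPath Γ} {m n : ℕ} (hmn : m ≤ n) (h : x.take n = y.take n) :
    x.take m = y.take m := by
  rw [take_eq_take_iff] at h ⊢
  exact ⟨h.1, fun i hi => h.2 i (hi.trans_le hmn)⟩

theorem drop_eq_of_le {x y : InfPath Γ} {m n : ℕ} (h : x.drop m = y.drop n) (i : ℕ) :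
    x.drop (m + i) = y.drop (n + i) := by
  refine InfPath.ext (funext fun j => ?_)
  have := congrFun (congrArg InfPath.edge h) (i + j)
  simpa only [InfPath.drop, add_assoc] using this

theorem eq_of_take_drop {x y : InfPath Γ} {n : ℕ} (h : x.take n = y.take n)
    (h' : x.drop n = y.drop n) : x = y := by
  have hx := x.concat_take_drop n
  have hy := y.concat_take_drop n
  rw [← hx, ← hy]
  congr 1

/-! ### Cylinder sets in the infinite path space -/

theorem mem_cylinder_take_iff {x y : InfPath Γ} {n : ℕ} :
    y ∈ cylinder (x.take n) ↔ y.take n = x.take n := by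
  rw [mem_cylinder_iff, InfPath.length_take]

theorem mem_cylinder_take (x : InfPath Γ) (n : ℕ) : x ∈ cylinder (x.take n) :=
  mem_cylinder_take_iff.2 rfl

theorem isOpen_cylinder (μ : FinPath Γ) : IsOpen (cylinder μ) :=
  isOpen_generateFrom_of_mem ⟨μ, rfl⟩

theorem cylinder_take_subset {μ : FinPath Γ} {x : InfPath Γ} (hx : x ∈ cylinder μ) {n : ℕ}
    (hn : μ.length ≤ n) : cylinder (x.take n) ⊆ cylinder μ := by
  intro y hy
  rw [mem_cylinder_take_iff] at hy
  rw [mem_cylinder_iff] at hx ⊢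
  rw [← hx, InfPath.length_take]
  exact take_eq_of_le hn hy

/-- The cylinder sets of the initial segments of `x` are a neighbourhood basis at `x`. -/
theorem exists_cylinder_take_subset {U : Set (InfPath Γ)} (hU : IsOpen U) {x : InfPath Γ}
    (hx : x ∈ U) : ∃ N, ∀ n, N ≤ n → cylinder (x.take n) ⊆ U := by
  induction hU with
  | basic s hs =>
    obtain ⟨μ, rfl⟩ := hs
    exact ⟨μ.length, fun n hn => cylinder_take_subset hx hn⟩
  | univ => exact ⟨0, fun _ _ => subset_univ _⟩
  | inter s t _ _ ihs iht =>
    obtain ⟨N, hN⟩ := ihs hx.1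
    obtain ⟨M, hM⟩ := iht hx.2
    exact ⟨max N M, fun n hn => subset_inter (hN n (le_of_max_le_left hn))
      (hM n (le_of_max_le_right hn))⟩
  | sUnion S _ ih =>
    obtain ⟨s, hs, hxs⟩ := hx
    obtain ⟨N, hN⟩ := ih s hs hxs
    exact ⟨N, fun n hn => (hN n hn).trans (subset_sUnion_of_mem hs)⟩

/-- A finite set of infinite paths can be separated from a point `x` by a cylinder set. -/
theorem exists_take_ne {F : Set (InfPath Γ)} (hF : F.Finite) (x : InfPath Γ) :
    ∃ n, ∀ y ∈ F, y.take n = x.take n → y = x := by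
  induction F, hF using Set.Finite.induction_on with
  | empty => exact ⟨0, fun _ h => h.elim⟩
  | @insert z F _ _ ih =>
    obtain ⟨n, hn⟩ := ih
    obtain ⟨m, hm⟩ : ∃ m, z.take m = x.take m → z = x := by
      by_cases hz : z = x
      · exact ⟨0, fun _ => hz⟩
      · have : ∃ i, z.edge i ≠ x.edge i := by
          by_contra! h
          exact hz (InfPath.ext (funext h))
        obtain ⟨i, hi⟩ := this
        exact ⟨i + 1, fun h => (hi ((take_eq_take_iff.1 h).2 i (Nat.lt_succ_self i))).elim⟩
    refine ⟨max n m, ?_⟩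
    rintro y (rfl | hy) h
    · exact hm (take_eq_of_le (le_max_right _ _) h)
    · exact hn y hy (take_eq_of_le (le_max_left _ _) h)

/-- If all paths near `x` are periodic from some fixed place on, with a fixed period, then `x`
is isolated. -/
theorem isIsolated_of_periodic {x : InfPath Γ} {U : Set (InfPath Γ)} (hU : IsOpen U)
    (hx : x ∈ U) {b p : ℕ} (hp : 0 < p)
    (h : ∀ y ∈ U, ∀ i, y.edge (b + p + i) = y.edge (b + i)) : IsIsolated x := by
  obtain ⟨N, hN⟩ := exists_cylinder_take_subset hU hx
  have key : cylinder (x.take (max N (b + p))) = {x} := by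
    refine Subset.antisymm (fun y hy => ?_) (singleton_subset_iff.2 (mem_cylinder_take _ _))
    have hyU := h y (hN _ (le_max_left _ _) hy)
    have hxU := h x hx
    rw [mem_cylinder_take_iff] at hy
    have hy' := (take_eq_take_iff.1 (take_eq_of_le (le_max_right N (b + p)) hy)).2
    refine InfPath.ext (funext fun i => ?_)
    induction i using Nat.strong_induction_on with
    | _ i ih =>
      by_cases hi : i < b + p
      · exact hy' i hi
      · obtain ⟨j, rfl⟩ := Nat.exists_eq_add_of_le (not_lt.1 hi)
        rw [hyU, hxU]
        exact ih _ (by omega)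
  unfold IsIsolated
  rw [← key]
  exact isOpen_cylinder _

/-! ### The basic open sets of the graph groupoid -/

theorem mem_bicylinder_iff {μ ν : FinPath Γ} {g : Arrow Γ} :
    g ∈ bicylinder μ ν ↔ g.left ∈ cylinder μ ∧ g.right ∈ cylinder ν ∧
      g.lag = (μ.length : ℤ) - ν.length ∧ g.left.drop μ.length = g.right.drop ν.length := by
  constructor
  · rintro ⟨z, hμ, hν, rfl⟩
    exact ⟨⟨z, hμ, rfl⟩, ⟨z, hν, rfl⟩, rfl, (drop_concat μ z hμ).trans (drop_concat ν z hν).symm⟩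
  · rintro ⟨⟨z, hμ, hz⟩, ⟨w, hν, hw⟩, hl, hd⟩
    rw [hz, hw, drop_concat, drop_concat] at hd
    subst hd
    exact ⟨z, hμ, hν, Arrow.ext hz hl hw⟩

theorem isOpen_bicylinder {μ ν : FinPath Γ} (h : μ.source = ν.source) :
    IsOpen (bicylinder μ ν) :=
  isOpen_generateFrom_of_mem ⟨μ, ν, h, rfl⟩

/-- `g.HasLegs a b` says that `g = (μ z, a - b, ν z)` with `|μ| = a` and `|ν| = b`. -/
def Arrow.HasLegs (g : Arrow Γ) (a b : ℕ) : Prop :=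
  g.lag = (a : ℤ) - b ∧ g.left.drop a = g.right.drop b

/-- The basic neighbourhood `Z(μ, ν)` of `g`, for the initial segments `μ` and `ν` of lengths
`a` and `b` of its range and its source. -/
def Arrow.nhd (g : Arrow Γ) (a b : ℕ) : Set (Arrow Γ) :=
  bicylinder (g.left.take a) (g.right.take b)

theorem Arrow.exists_hasLegs (g : Arrow Γ) : ∃ a b, g.HasLegs a b := by
  obtain ⟨a, b, hl, h⟩ := g.shift
  exact ⟨a, b, hl.symm, InfPath.ext (funext h)⟩

theorem Arrow.HasLegs.add {g : Arrow Γ} {a b : ℕ} (h : g.HasLegs a b) (i : ℕ) :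
    g.HasLegs (a + i) (b + i) :=
  ⟨by rw [h.1]; push_cast; ring, drop_eq_of_le h.2 i⟩

theorem mem_bicylinder_iff_hasLegs {μ ν : FinPath Γ} {g : Arrow Γ} :
    g ∈ bicylinder μ ν ↔ g.left ∈ cylinder μ ∧ g.right ∈ cylinder ν ∧
      g.HasLegs μ.length ν.length :=
  mem_bicylinder_iff

theorem Arrow.mem_nhd_iff {g h : Arrow Γ} {a b : ℕ} :
    h ∈ g.nhd a b ↔ h.left.take a = g.left.take a ∧ h.right.take b = g.right.take b ∧
      h.HasLegs a b := by
  rw [Arrow.nhd, mem_bicylinder_iff_hasLegs, mem_cylinder_take_iff, mem_cylinder_take_iff,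
    InfPath.length_take, InfPath.length_take]

theorem Arrow.HasLegs.mem_nhd {g : Arrow Γ} {a b : ℕ} (h : g.HasLegs a b) : g ∈ g.nhd a b :=
  Arrow.mem_nhd_iff.2 ⟨rfl, rfl, h⟩

theorem Arrow.HasLegs.source_eq {g : Arrow Γ} {a b : ℕ} (h : g.HasLegs a b) :
    (g.left.take a).source = (g.right.take b).source := by
  rw [InfPath.source_take, InfPath.source_take, h.2]

theorem Arrow.HasLegs.isOpen_nhd {g : Arrow Γ} {a b : ℕ} (h : g.HasLegs a b) :
    IsOpen (g.nhd a b) :=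
  isOpen_bicylinder h.source_eq

/-- Lengthening the legs of a basic open set at one of its points makes it smaller. -/
theorem Arrow.HasLegs.nhd_subset {g : Arrow Γ} {μ ν : FinPath Γ} {a b : ℕ} (h : g.HasLegs a b)
    (hg : g ∈ bicylinder μ ν) (ha : μ.length ≤ a) : g.nhd a b ⊆ bicylinder μ ν := by
  intro k hk
  rw [Arrow.mem_nhd_iff] at hk
  rw [mem_bicylinder_iff_hasLegs] at hg ⊢
  obtain ⟨h1, h2, h3⟩ := hg
  have e1 := h.1
  have e3 := h3.1
  have hb : ν.length ≤ b := by omega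
  have hl : k.left ∈ cylinder μ := cylinder_take_subset h1 ha (mem_cylinder_take_iff.2 hk.1)
  have hr : k.right ∈ cylinder ν := cylinder_take_subset h2 hb (mem_cylinder_take_iff.2 hk.2.1)
  refine ⟨hl, hr, by rw [hk.2.2.1, ← e1, e3], ?_⟩
  -- the two tails agree with those of `g` up to the legs `a` and `b`, and with each other beyond
  refine InfPath.ext (funext fun i => ?_)
  change k.left.edge (μ.length + i) = k.right.edge (ν.length + i)
  by_cases hi : μ.length + i < a
  · rw [(take_eq_take_iff.1 hk.1).2 _ hi, (take_eq_take_iff.1 hk.2.1).2 _ (by omega)]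
    exact congrFun (congrArg InfPath.edge h3.2) i
  · have := congrFun (congrArg InfPath.edge hk.2.2.2) (μ.length + i - a)
    change k.left.edge _ = k.right.edge _ at this
    rwa [show a + (μ.length + i - a) = μ.length + i by omega,
      show b + (μ.length + i - a) = ν.length + i by omega] at this

/-- The sets `g.nhd a b` are a neighbourhood basis at `g`. -/
theorem Arrow.exists_nhd_subset {U : Set (Arrow Γ)} (hU : IsOpen U) {g : Arrow Γ} (hg : g ∈ U) :
    ∃ N, ∀ a b, N ≤ a → g.HasLegs a b → g.nhd a b ⊆ U := by
  induction hU with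
  | basic s hs =>
    obtain ⟨μ, ν, _, rfl⟩ := hs
    exact ⟨μ.length, fun a b ha h => h.nhd_subset hg ha⟩
  | univ => exact ⟨0, fun _ _ _ _ => subset_univ _⟩
  | inter s t _ _ ihs iht =>
    obtain ⟨N, hN⟩ := ihs hg.1
    obtain ⟨M, hM⟩ := iht hg.2
    exact ⟨max N M, fun a b ha h => subset_inter (hN a b (le_of_max_le_left ha) h)
      (hM a b (le_of_max_le_right ha) h)⟩
  | sUnion S _ ih =>
    obtain ⟨s, hs, hxs⟩ := hg
    obtain ⟨N, hN⟩ := ih s hs hxs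
    exact ⟨N, fun a b ha h => (hN a b ha h).trans (subset_sUnion_of_mem hs)⟩

theorem Arrow.exists_hasLegs_ge (g : Arrow Γ) (N : ℕ) :
    ∃ a b, N ≤ a ∧ N ≤ b ∧ g.HasLegs a b := by
  obtain ⟨a, b, h⟩ := g.exists_hasLegs
  exact ⟨a + N, b + N, Nat.le_add_left _ _, Nat.le_add_left _ _, h.add N⟩

/-- A basic open set is closed: a neighbourhood `g.nhd a b` with long legs that meets `Z(μ, ν)`
is contained in it. -/
theorem isClosed_bicylinder (μ ν : FinPath Γ) : IsClosed (bicylinder μ ν) := by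
  rw [← isOpen_compl_iff, isOpen_iff_forall_mem_open]
  intro g hg
  obtain ⟨a, b, ha, hb, h⟩ := g.exists_hasLegs_ge (max μ.length ν.length)
  refine ⟨g.nhd a b, fun k hk hk' => hg ?_, h.isOpen_nhd, h.mem_nhd⟩
  obtain ⟨h1, h2, h3⟩ := Arrow.mem_nhd_iff.1 hk
  refine h3.nhd_subset hk' (le_of_max_le_left ha) (Arrow.mem_nhd_iff.2 ⟨h1.symm, h2.symm, h⟩)

theorem isClopen_bicylinder {μ ν : FinPath Γ} (h : μ.source = ν.source) :
    IsClopen (bicylinder μ ν) :=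
  ⟨isClosed_bicylinder μ ν, isOpen_bicylinder h⟩

theorem Arrow.inv_inv (g : Arrow Γ) : g.inv.inv = g :=
  Arrow.ext rfl (neg_neg _) rfl

theorem inv_mem_bicylinder_iff {μ ν : FinPath Γ} {g : Arrow Γ} :
    g.inv ∈ bicylinder μ ν ↔ g ∈ bicylinder ν μ := by
  rw [mem_bicylinder_iff, mem_bicylinder_iff]
  change (_ ∧ _ ∧ -g.lag = _ ∧ g.right.drop _ = g.left.drop _) ↔ _
  constructor
  · rintro ⟨h1, h2, h3, h4⟩
    exact ⟨h2, h1, by omega, h4.symm⟩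
  · rintro ⟨h1, h2, h3, h4⟩
    exact ⟨h2, h1, by omega, h4.symm⟩

theorem Arrow.HasLegs.mul {g h : Arrow Γ} {e : g.right = h.left} {a b c : ℕ}
    (hg : g.HasLegs a b) (hh : h.HasLegs b c) : (g.mul h e).HasLegs a c := by
  refine ⟨?_, ?_⟩
  · change g.lag + h.lag = _
    rw [hg.1, hh.1]; ring
  · change g.left.drop a = h.right.drop c
    rw [hg.2, e, hh.2]

theorem mul_mem_nhd {g h g' h' : Arrow Γ} {e : g.right = h.left} {e' : g'.right = h'.left}
    {a b c : ℕ} (hg : g' ∈ g.nhd a b) (hh : h' ∈ h.nhd b c) :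
    g'.mul h' e' ∈ (g.mul h e).nhd a c := by
  rw [Arrow.mem_nhd_iff] at *
  exact ⟨hg.1, hh.2.1, hg.2.2.mul hh.2.2⟩

/-- The source map sends `g.nhd a b` onto the cylinder set of an initial segment of the source
of `g`. -/
theorem exists_right_eq_of_mem_cylinder {g : Arrow Γ} {a b : ℕ} (h : g.HasLegs a b)
    {y : InfPath Γ} (hy : y ∈ cylinder (g.right.take b)) : ∃ k ∈ g.nhd a b, k.right = y := by
  obtain ⟨z, hz, rfl⟩ := hy
  exact ⟨arrowOf _ _ z (h.source_eq.trans hz) hz, ⟨z, _, _, rfl⟩, rfl⟩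

/-- The range map is injective on a basic open set. -/
theorem injOn_left_bicylinder (μ ν : FinPath Γ) : InjOn Arrow.left (bicylinder μ ν) := by
  intro g hg h hh e
  rw [mem_bicylinder_iff] at hg hh
  obtain ⟨-, h2, h3, h4⟩ := hg
  obtain ⟨-, k2, k3, k4⟩ := hh
  refine Arrow.ext e (h3.trans k3.symm) (eq_of_take_drop (n := ν.length) ?_ ?_)
  · rw [mem_cylinder_iff.1 h2, mem_cylinder_iff.1 k2]
  · rw [← h4, ← k4, e]

theorem injOn_right_bicylinder (μ ν : FinPath Γ) : InjOn Arrow.right (bicylinder μ ν) := by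
  intro g hg h hh e
  have := injOn_left_bicylinder ν μ (inv_mem_bicylinder_iff.2 hg) (inv_mem_bicylinder_iff.2 hh) e
  rw [← g.inv_inv, this, h.inv_inv]

theorem continuous_arrow_inv : Continuous (Arrow.inv : Arrow Γ → Arrow Γ) := by
  refine continuous_generateFrom_iff.2 ?_
  rintro _ ⟨μ, ν, h, rfl⟩
  have : Arrow.inv ⁻¹' bicylinder μ ν = bicylinder ν μ := ext fun g => inv_mem_bicylinder_iff
  rw [this]
  exact isOpen_bicylinder h.symm

theorem continuous_arrow_mul :
    Continuous fun p : {p : Arrow Γ × Arrow Γ // p.1.right = p.2.left} =>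
      p.1.1.mul p.1.2 p.2 := by
  rw [continuous_def]
  intro U hU
  rw [isOpen_iff_forall_mem_open]
  rintro ⟨⟨g, h⟩, e⟩ hp
  obtain ⟨N, hN⟩ := Arrow.exists_nhd_subset hU hp
  obtain ⟨a, b, hg⟩ := g.exists_hasLegs
  obtain ⟨b', c, hh⟩ := h.exists_hasLegs
  -- `b + b'` is a common length for the two middle legs
  have hg' := (hg.add b').add N
  have hh' := (hh.add b).add N
  rw [Nat.add_comm b' b] at hh'
  refine ⟨{p | p.1.1 ∈ g.nhd _ _ ∧ p.1.2 ∈ h.nhd _ _}, ?_, ?_, hg'.mem_nhd, hh'.mem_nhd⟩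
  · rintro ⟨⟨g', h'⟩, e'⟩ ⟨h1, h2⟩
    exact hN _ _ (Nat.le_add_left _ _) (hg'.mul hh' (e := e)) (mul_mem_nhd h1 h2)
  · exact (hg'.isOpen_nhd.preimage (continuous_fst.comp continuous_subtype_val)).inter
      (hh'.isOpen_nhd.preimage (continuous_snd.comp continuous_subtype_val))

end Paths

/-! ### Bisections and products of sets of arrows -/

section Bisections

universe u v

variable {V : Type u} {E : Type v} {Γ : DirectedGraph V E}

/-- A set of arrows on which both the range and the source map are injective. -/
def IsBisection (B : Set (Arrow Γ)) : Prop := InjOn Arrow.left B ∧ InjOn Arrow.right B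

/-- The set of all products of composable pairs in `B × C`. -/
def prodSet (B C : Set (Arrow Γ)) : Set (Arrow Γ) :=
  {k | ∃ g ∈ B, ∃ h ∈ C, ∃ e : g.right = h.left, k = g.mul h e}

theorem isBisection_bicylinder (μ ν : FinPath Γ) : IsBisection (bicylinder μ ν) :=
  ⟨injOn_left_bicylinder μ ν, injOn_right_bicylinder μ ν⟩

theorem isBisection_range_unit : IsBisection (Set.range (Arrow.unit (Γ := Γ))) := by
  constructor
  · rintro _ ⟨x, rfl⟩ _ ⟨y, rfl⟩ h
    exact congrArg Arrow.unit h
  · rintro _ ⟨x, rfl⟩ _ ⟨y, rfl⟩ h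
    exact congrArg Arrow.unit h

theorem IsBisection.subset {B C : Set (Arrow Γ)} (hC : IsBisection C) (h : B ⊆ C) :
    IsBisection B :=
  ⟨hC.1.mono h, hC.2.mono h⟩

theorem IsBisection.inv {B : Set (Arrow Γ)} (hB : IsBisection B) :
    IsBisection (Arrow.inv ⁻¹' B) := by
  constructor
  · intro g hg h hh e
    rw [← g.inv_inv, hB.2 hg hh e, h.inv_inv]
  · intro g hg h hh e
    rw [← g.inv_inv, hB.1 hg hh e, h.inv_inv]

theorem IsBisection.prod {B C : Set (Arrow Γ)} (hB : IsBisection B) (hC : IsBisection C) :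
    IsBisection (prodSet B C) := by
  constructor
  · rintro _ ⟨g, hg, h, hh, e, rfl⟩ _ ⟨g', hg', h', hh', e', rfl⟩ heq
    obtain rfl := hB.1 hg hg' heq
    obtain rfl := hC.1 hh hh' (e.symm.trans e')
    rfl
  · rintro _ ⟨g, hg, h, hh, e, rfl⟩ _ ⟨g', hg', h', hh', e', rfl⟩ heq
    obtain rfl := hC.2 hh hh' heq
    obtain rfl := hB.2 hg hg' (e.trans e'.symm)
    rfl

theorem Arrow.inv_mul_cancel_left (g h : Arrow Γ) (e : g.right = h.left) :
    g.inv.mul (g.mul h e) rfl = h :=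
  Arrow.ext e (by simp [Arrow.mul, Arrow.inv]) rfl

theorem Arrow.mul_inv_cancel_left (g k : Arrow Γ) (e : g.left = k.left) :
    g.mul (g.inv.mul k e) rfl = k :=
  Arrow.ext e (by simp [Arrow.mul, Arrow.inv]) rfl

theorem Arrow.mul_inv_self (g : Arrow Γ) : g.mul g.inv rfl = Arrow.unit g.left :=
  Arrow.ext rfl (add_neg_cancel _) rfl

theorem Arrow.inv_mul_self (g : Arrow Γ) : g.inv.mul g rfl = Arrow.unit g.right :=
  Arrow.ext rfl (neg_add_cancel _) rfl

theorem Arrow.HasLegs.inv {g : Arrow Γ} {a b : ℕ} (h : g.HasLegs a b) : g.inv.HasLegs b a := by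
  refine ⟨?_, h.2.symm⟩
  change -g.lag = _
  rw [h.1]; ring

/-- `Z(μ, ν) Z(α, β)` is empty or a basic open set. -/
theorem prodSet_bicylinder (μ ν α β : FinPath Γ) :
    prodSet (bicylinder μ ν) (bicylinder α β) = ∅ ∨ ∃ μ' β' : FinPath Γ, μ'.source = β'.source ∧
      prodSet (bicylinder μ ν) (bicylinder α β) = bicylinder μ' β' := by
  rcases (prodSet (bicylinder μ ν) (bicylinder α β)).eq_empty_or_nonempty with h0 | h0
  · exact Or.inl h0
  right
  obtain ⟨_, g, hg, h, hh, e, rfl⟩ := h0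
  -- lengthen the legs of `g` and `h` so that the middle ones have a common length
  obtain ⟨b, hbν, hbα, hb⟩ : ∃ b, ν.length ≤ b ∧ α.length ≤ b ∧ (b = ν.length ∨ b = α.length) :=
    ⟨max ν.length α.length, le_max_left _ _, le_max_right _ _, max_choice _ _⟩
  have hgl : g.HasLegs (μ.length + (b - ν.length)) b := by
    have := (mem_bicylinder_iff_hasLegs.1 hg).2.2.add (b - ν.length)
    rwa [show ν.length + (b - ν.length) = b by omega] at this
  have hhl : h.HasLegs b (β.length + (b - α.length)) := by
    have := (mem_bicylinder_iff_hasLegs.1 hh).2.2.add (b - α.length)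
    rwa [show α.length + (b - α.length) = b by omega] at this
  have hgn := hgl.nhd_subset hg (Nat.le_add_right _ _)
  have hhn := hhl.nhd_subset hh hbα
  refine ⟨_, _, (hgl.mul hhl (e := e)).source_eq, Subset.antisymm ?_ ?_⟩
  · rintro _ ⟨g', hg', h', hh', e', rfl⟩
    have hy : g'.right.take b = g.right.take b := by
      rcases hb with rfl | rfl
      · rw [mem_cylinder_iff.1 (mem_bicylinder_iff.1 hg).2.1,
          mem_cylinder_iff.1 (mem_bicylinder_iff.1 hg').2.1]
      · rw [e, e', mem_cylinder_iff.1 (mem_bicylinder_iff.1 hh).1,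
          mem_cylinder_iff.1 (mem_bicylinder_iff.1 hh').1]
    obtain ⟨k, hk, hky⟩ := exists_right_eq_of_mem_cylinder hgl (mem_cylinder_take_iff.2 hy)
    obtain ⟨l, hl, hly⟩ := exists_right_eq_of_mem_cylinder hhl.inv
      (y := h'.left) (mem_cylinder_take_iff.2 (by rw [← e', hy, e]; rfl))
    obtain rfl := injOn_right_bicylinder _ _ (hgn hk) hg' hky
    have hl' : l.inv ∈ h.nhd _ _ := inv_mem_bicylinder_iff.2 hl
    obtain rfl := injOn_left_bicylinder _ _ (hhn hl') hh' hly
    exact mul_mem_nhd hk hl'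
  · intro k hk
    obtain ⟨l, hl, hlk⟩ := exists_right_eq_of_mem_cylinder hgl.inv (y := k.left)
      (mem_bicylinder_iff.1 hk).1
    have hl' : l.inv ∈ g.nhd _ _ := inv_mem_bicylinder_iff.2 hl
    have := mul_mem_nhd (e := rfl) (e' := hlk) (g := g.inv) (h := g.mul h e) hl hk
    rw [Arrow.inv_mul_cancel_left] at this
    refine ⟨l.inv, hgn hl', l.mul k hlk, hhn this, rfl, ?_⟩
    exact Arrow.ext hlk.symm (neg_add_cancel_left l.lag k.lag).symm rfl

end Bisections

/-! ### Convolution in the Leavitt path algebra -/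

section Algebra

universe u v w

variable {V : Type u} {E : Type v} {Γ : DirectedGraph V E} {R : Type w} [CommRing R]

open Function in
theorem support_charFun [Nontrivial R] (B : Set (Arrow Γ)) : support (charFun R B) = B := by
  rw [charFun, support_indicator, support_const one_ne_zero, inter_univ]

theorem conv_eq_zero {f g : Arrow Γ → R} {k : Arrow Γ}
    (h : ∀ a b, ∀ e : a.right = b.left, k = a.mul b e → f a * g b = 0) : conv f g k = 0 := by
  refine finsum_eq_zero_of_forall_eq_zero fun ⟨a, ha⟩ => ?_
  exact h a (a.inv.mul k ha) rfl (a.mul_inv_cancel_left k ha).symm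

/-- A convolution with a single nonzero term. -/
theorem conv_mul_eq {f g : Arrow Γ → R} {a b : Arrow Γ} {e : a.right = b.left}
    (h : ∀ a' b', ∀ e' : a'.right = b'.left, a'.mul b' e' = a.mul b e → a' ≠ a →
      f a' * g b' = 0) :
    conv f g (a.mul b e) = f a * g b := by
  unfold conv
  rw [finsum_eq_single _ (⟨a, rfl⟩ : {η : Arrow Γ // η.left = (a.mul b e).left})]
  · rw [Arrow.inv_mul_cancel_left]
  · rintro ⟨a', ha'⟩ hne
    exact h a' (a'.inv.mul _ ha') rfl (a'.mul_inv_cancel_left _ ha')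
      fun h => hne (Subtype.ext h)

open Function in
theorem conv_mul_eq_of_injOn {f g : Arrow Γ → R} (hf : InjOn Arrow.left (support f))
    {a b : Arrow Γ} (ha : f a ≠ 0) (e : a.right = b.left) :
    conv f g (a.mul b e) = f a * g b := by
  refine conv_mul_eq fun a' b' e' heq hne => ?_
  by_contra h
  exact hne (hf (left_ne_zero_of_mul h) ha (congrArg Arrow.left heq :))

open Function in
theorem conv_mul_ne_zero [IsDomain R] {f g : Arrow Γ → R} (hf : InjOn Arrow.left (support f))
    {a b : Arrow Γ} (ha : f a ≠ 0) (hb : g b ≠ 0) (e : a.right = b.left) :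
    conv f g (a.mul b e) ≠ 0 := by
  rw [conv_mul_eq_of_injOn hf ha]
  exact mul_ne_zero ha hb

open Function in
theorem support_conv [IsDomain R] {f g : Arrow Γ → R} (hf : InjOn Arrow.left (support f)) :
    support (conv f g) = prodSet (support f) (support g) := by
  ext k
  constructor
  · intro hk
    by_contra hn
    refine hk (conv_eq_zero fun a b e h => ?_)
    by_contra hab
    exact hn ⟨a, left_ne_zero_of_mul hab, b, right_ne_zero_of_mul hab, e, h⟩
  · rintro ⟨a, ha, b, hb, e, rfl⟩
    exact conv_mul_ne_zero hf ha hb e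

theorem conv_charFun {B C : Set (Arrow Γ)} (hB : InjOn Arrow.left B) :
    conv (charFun R B) (charFun R C) = charFun R (prodSet B C) := by
  nontriviality R
  funext k
  by_cases hk : k ∈ prodSet B C
  · rw [charFun, charFun, charFun, indicator_of_mem hk]
    obtain ⟨a, ha, b, hb, e, rfl⟩ := hk
    rw [conv_mul_eq_of_injOn (by rwa [← charFun, support_charFun]), indicator_of_mem ha,
      indicator_of_mem hb, one_mul]
    rw [indicator_of_mem ha]
    exact one_ne_zero
  · rw [charFun, charFun, charFun, indicator_of_notMem hk]
    refine conv_eq_zero fun a b e h => ?_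
    by_contra hab
    exact hk ⟨a, mem_of_indicator_ne_zero (left_ne_zero_of_mul hab), b,
      mem_of_indicator_ne_zero (right_ne_zero_of_mul hab), e, h⟩

/-- Every infinite path is the range of finitely many arrows in the support of `f`; this makes
the sums in `conv f g` finite. -/
def LeftFinite (f : Arrow Γ → R) : Prop := ∀ x : InfPath Γ, {k | f k ≠ 0 ∧ k.left = x}.Finite

theorem LeftFinite.finite_support {f : Arrow Γ → R} (hf : LeftFinite f) (g : Arrow Γ → R)
    (k : Arrow Γ) : (Function.support fun a : {a : Arrow Γ // a.left = k.left} =>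
      f a.1 * g (a.1.inv.mul k a.2)).Finite := by
  refine ((hf k.left).preimage (f := Subtype.val) Subtype.val_injective.injOn).subset ?_
  rintro ⟨a, ha⟩ h
  exact ⟨left_ne_zero_of_mul h, ha⟩

theorem conv_add_left {f f' : Arrow Γ → R} (hf : LeftFinite f) (hf' : LeftFinite f')
    (g : Arrow Γ → R) : conv (f + f') g = conv f g + conv f' g := by
  funext k
  simp only [conv, Pi.add_apply, add_mul]
  exact finsum_add_distrib (hf.finite_support g k) (hf'.finite_support g k)

theorem conv_add_right {f : Arrow Γ → R} (hf : LeftFinite f) (g g' : Arrow Γ → R) :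
    conv f (g + g') = conv f g + conv f g' := by
  funext k
  simp only [conv, Pi.add_apply, mul_add]
  exact finsum_add_distrib (hf.finite_support g k) (hf.finite_support g' k)

theorem conv_smul_left {f : Arrow Γ → R} (hf : LeftFinite f) (c : R) (g : Arrow Γ → R) :
    conv (c • f) g = c • conv f g := by
  funext k
  simp only [conv, Pi.smul_apply, smul_eq_mul, mul_assoc]
  exact (mul_finsum' _ _ (hf.finite_support g k)).symm

theorem conv_smul_right {f : Arrow Γ → R} (hf : LeftFinite f) (c : R) (g : Arrow Γ → R) :
    conv f (c • g) = c • conv f g := by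
  funext k
  simp only [conv, Pi.smul_apply, smul_eq_mul, mul_left_comm _ c]
  exact (mul_finsum' _ _ (hf.finite_support g k)).symm

theorem charFun_mem_leavitt {μ ν : FinPath Γ} (h : μ.source = ν.source) :
    charFun R (bicylinder μ ν) ∈ leavitt Γ R :=
  Submodule.subset_span ⟨μ, ν, h, rfl⟩

theorem leftFinite_of_mem_leavitt {f : Arrow Γ → R} (hf : f ∈ leavitt Γ R) : LeftFinite f := by
  induction hf using Submodule.span_induction with
  | mem f hf =>
    obtain ⟨μ, ν, _, rfl⟩ := hf
    refine fun x => Set.Subsingleton.finite ?_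
    rintro g ⟨hg, rfl⟩ h ⟨hh, e⟩
    exact injOn_left_bicylinder μ ν (mem_of_indicator_ne_zero hg) (mem_of_indicator_ne_zero hh)
      e.symm
  | zero => exact fun x => by simp
  | add f g _ _ ihf ihg =>
    refine fun x => ((ihf x).union (ihg x)).subset ?_
    rintro k ⟨hk, hx⟩
    by_cases h : f k = 0
    · exact Or.inr ⟨fun h' => hk (by simp [h, h']), hx⟩
    · exact Or.inl ⟨h, hx⟩
  | smul c f _ ih =>
    exact fun x => (ih x).subset fun k hk => ⟨right_ne_zero_of_mul hk.1, hk.2⟩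

theorem conv_mem_leavitt {f g : Arrow Γ → R} (hf : f ∈ leavitt Γ R) (hg : g ∈ leavitt Γ R) :
    conv f g ∈ leavitt Γ R := by
  induction hf using Submodule.span_induction with
  | mem f hf =>
    have hf' : LeftFinite f := leftFinite_of_mem_leavitt (Submodule.subset_span hf)
    obtain ⟨μ, ν, hμν, rfl⟩ := hf
    induction hg using Submodule.span_induction with
    | mem g hg =>
      obtain ⟨α, β, hαβ, rfl⟩ := hg
      rw [conv_charFun (injOn_left_bicylinder μ ν)]
      rcases prodSet_bicylinder μ ν α β with h | ⟨μ', β', h, h'⟩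
      · rw [h, charFun, indicator_empty]
        exact Submodule.zero_mem _
      · rw [h']
        exact charFun_mem_leavitt h
    | zero =>
      convert Submodule.zero_mem (leavitt Γ R)
      exact funext fun k => conv_eq_zero fun a b e h => mul_zero _
    | add g g' _ _ ih ih' =>
      rw [conv_add_right hf']
      exact Submodule.add_mem _ ih ih'
    | smul c g _ ih =>
      rw [conv_smul_right hf']
      exact Submodule.smul_mem _ _ ih
  | zero =>
    convert Submodule.zero_mem (leavitt Γ R)
    exact funext fun k => conv_eq_zero fun a b e h => zero_mul _
  | add f f' hf hf' ih ih' =>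
    rw [conv_add_left (leftFinite_of_mem_leavitt hf) (leftFinite_of_mem_leavitt hf')]
    exact Submodule.add_mem _ ih ih'
  | smul c f hf ih =>
    rw [conv_smul_left (leftFinite_of_mem_leavitt hf)]
    exact Submodule.smul_mem _ _ ih

theorem unit_mem_bicylinder_self {μ : FinPath Γ} {x : InfPath Γ} :
    Arrow.unit x ∈ bicylinder μ μ ↔ x ∈ cylinder μ := by
  rw [mem_bicylinder_iff]
  exact ⟨fun h => h.1, fun h => ⟨h, h, (sub_self _).symm, rfl⟩⟩

theorem bicylinder_self_subset (μ : FinPath Γ) :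
    bicylinder μ μ ⊆ Set.range (Arrow.unit (Γ := Γ)) := fun g hg =>
  ⟨g.left, injOn_left_bicylinder μ μ
    (unit_mem_bicylinder_self.2 (mem_bicylinder_iff.1 hg).1) hg rfl⟩

/-- The restriction to the unit space maps the Leavitt path algebra into the diagonal. -/
theorem indicator_unit_mem_diagonal {f : Arrow Γ → R} (hf : f ∈ leavitt Γ R) :
    (Set.range (Arrow.unit (Γ := Γ))).indicator f ∈ diagonal Γ R := by
  induction hf using Submodule.span_induction with
  | mem f hf =>
    obtain ⟨μ, ν, _, rfl⟩ := hf
    rw [charFun, indicator_indicator]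
    rcases (Set.range (Arrow.unit (Γ := Γ)) ∩ bicylinder μ ν).eq_empty_or_nonempty with h | h
    · rw [h, indicator_empty]
      exact Submodule.zero_mem _
    · obtain ⟨_, ⟨x, rfl⟩, hx⟩ := h
      obtain ⟨h1, h2, h3, -⟩ := mem_bicylinder_iff.1 hx
      -- a unit in `Z(μ, ν)` forces `|μ| = |ν|`, hence `μ = ν`
      have hl : μ.length = ν.length := by
        change (0 : ℤ) = _ at h3
        omega
      obtain rfl : μ = ν := by
        rw [← mem_cylinder_iff.1 h1, ← mem_cylinder_iff.1 h2, hl]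
        rfl
      rw [inter_eq_self_of_subset_right (bicylinder_self_subset μ)]
      exact Submodule.subset_span ⟨μ, rfl⟩
  | zero =>
    rw [indicator_zero']
    exact Submodule.zero_mem _
  | add f g _ _ ihf ihg =>
    rw [indicator_add']
    exact Submodule.add_mem _ ihf ihg
  | smul c f _ ih =>
    convert Submodule.smul_mem _ c ih
    exact indicator_const_smul _ c f

/-- The diagonal consists of the elements of the Leavitt path algebra that are supported on the
unit space. -/
theorem mem_diagonal_iff {f : Arrow Γ → R} : f ∈ diagonal Γ R ↔
    f ∈ leavitt Γ R ∧ Function.support f ⊆ Set.range (Arrow.unit (Γ := Γ)) := by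
  constructor
  · intro hf
    refine ⟨Submodule.span_mono ?_ hf, ?_⟩
    · rintro _ ⟨μ, rfl⟩
      exact ⟨μ, μ, rfl, rfl⟩
    · induction hf using Submodule.span_induction with
      | mem f hf =>
        obtain ⟨μ, rfl⟩ := hf
        exact fun g hg => bicylinder_self_subset μ (mem_of_indicator_ne_zero hg)
      | zero => simp
      | add f g _ _ ihf ihg =>
        exact (Function.support_add f g).trans (union_subset ihf ihg)
      | smul c f _ ih => exact (Function.support_const_smul_subset c f).trans ih
  · rintro ⟨hf, hs⟩
    rw [← indicator_eq_self.2 hs]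
    exact indicator_unit_mem_diagonal hf

/-- The elements of the Leavitt path algebra are locally constant. -/
theorem isLocallyConstant_of_mem_leavitt {f : Arrow Γ → R} (hf : f ∈ leavitt Γ R) :
    IsLocallyConstant f := by
  induction hf using Submodule.span_induction with
  | mem f hf =>
    obtain ⟨μ, ν, h, rfl⟩ := hf
    convert (LocallyConstant.charFn R (isClopen_bicylinder h)).isLocallyConstant
    exact (LocallyConstant.coe_charFn R _).symm
  | zero => exact IsLocallyConstant.const 0
  | add f g _ _ ihf ihg => exact ihf.add ihg
  | smul c f _ ih => exact (IsLocallyConstant.const c).mul ih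

theorem isOpen_support_of_mem_leavitt {f : Arrow Γ → R} (hf : f ∈ leavitt Γ R) :
    IsOpen (Function.support f) :=
  isLocallyConstant_of_mem_leavitt hf {0}ᶜ

/-! ### Normalizers are the elements supported on bisections -/

variable [StarRing R]

theorem adj_adj (f : Arrow Γ → R) : adj (adj f) = f := by
  funext k
  rw [adj, adj, star_star, Arrow.inv_inv]

theorem adj_apply_ne_zero {f : Arrow Γ → R} {k : Arrow Γ} : adj f k ≠ 0 ↔ f k.inv ≠ 0 :=
  star_ne_zero

theorem support_adj (f : Arrow Γ → R) :
    Function.support (adj f) = Arrow.inv ⁻¹' Function.support f :=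
  ext fun _ => adj_apply_ne_zero

theorem adj_mem_leavitt {f : Arrow Γ → R} (hf : f ∈ leavitt Γ R) : adj f ∈ leavitt Γ R := by
  induction hf using Submodule.span_induction with
  | mem f hf =>
    obtain ⟨μ, ν, h, rfl⟩ := hf
    convert charFun_mem_leavitt (R := R) h.symm
    funext k
    by_cases hk : k ∈ bicylinder ν μ
    · rw [adj, charFun, charFun, indicator_of_mem hk,
        indicator_of_mem (inv_mem_bicylinder_iff.2 hk), star_one]
    · rw [adj, charFun, charFun, indicator_of_notMem hk,
        indicator_of_notMem (fun h => hk (inv_mem_bicylinder_iff.1 h)), star_zero]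
  | zero =>
    convert Submodule.zero_mem (leavitt Γ R)
    exact funext fun k => star_zero _
  | add f g _ _ ihf ihg =>
    convert Submodule.add_mem _ ihf ihg
    exact funext fun k => star_add _ _
  | smul c f _ ih =>
    convert Submodule.smul_mem _ (star c) ih
    exact funext fun k => by simp [adj]

variable [IsDomain R]

/-- If `n d n^*` is in the diagonal for all `d` in the diagonal, then for every `x` there is at
most one arrow with source `x` at which `n` does not vanish: for arrows `g` of largest lag and `h`
of smallest lag with source `x` and given ranges, a single term contributes to the value of
`n d n^*` at `g h⁻¹` when `d` is the characteristic function of a small neighbourhood of `x`, so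
`g h⁻¹` is a unit. -/
theorem injOn_right_support {n : Arrow Γ → R} (hn : n ∈ leavitt Γ R)
    (hd : ∀ d ∈ diagonal Γ R, conv (conv n d) (adj n) ∈ diagonal Γ R) :
    InjOn Arrow.right (Function.support n) := by
  have hfin : ∀ x y : InfPath Γ, {k | n k ≠ 0 ∧ k.left = y ∧ k.right = x}.Finite := fun x y =>
    (leftFinite_of_mem_leavitt hn y).subset fun k hk => ⟨hk.1, hk.2.1⟩
  intro g hg h hh hgh
  obtain ⟨g', ⟨hg', hgl, hgr⟩, hmax⟩ := Set.exists_max_image _ Arrow.lag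
    (hfin g.right g.left) ⟨g, hg, rfl, rfl⟩
  obtain ⟨h', ⟨hh', hhl, hhr⟩, hmin⟩ := Set.exists_min_image _ Arrow.lag
    (hfin g.right h.left) ⟨h, hh, rfl, hgh.symm⟩
  -- the cylinder of `x = s(g)` of length `N` contains no other source of an arrow in the support
  -- of `n` with range `r(g)`
  obtain ⟨N, hN⟩ := exists_take_ne ((leftFinite_of_mem_leavitt hn g.left).image Arrow.right)
    g.right
  set d : Arrow Γ → R := charFun R (bicylinder (g.right.take N) (g.right.take N)) with hddef
  have hdiag : d ∈ diagonal Γ R := Submodule.subset_span ⟨_, rfl⟩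
  have hnd : ∀ k, conv n d k = n k * d (Arrow.unit k.right) := by
    intro k
    have hk : k = k.mul (Arrow.unit k.right) rfl := Arrow.ext rfl (add_zero _).symm rfl
    conv_lhs => rw [hk]
    refine conv_mul_eq fun a b e heq hne => ?_
    rw [← hk] at heq
    by_cases hb : d b = 0
    · rw [hb, mul_zero]
    · obtain ⟨x, rfl⟩ := (mem_diagonal_iff.1 hdiag).2 hb
      exact (hne (heq ▸ Arrow.ext rfl (add_zero _).symm e)).elim
  have hd1 : d (Arrow.unit g.right) = 1 :=
    indicator_of_mem (unit_mem_bicylinder_self.2 (mem_cylinder_take _ _)) _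
  have hval : conv (conv n d) (adj n) (g'.mul h'.inv (hgr.trans hhr.symm)) ≠ 0 := by
    rw [conv_mul_eq]
    · rw [hnd, hgr, hd1, mul_one]
      exact mul_ne_zero hg' (adj_apply_ne_zero.2 (by rwa [Arrow.inv_inv]))
    · intro a b e heq hne
      by_contra hab
      have ha := left_ne_zero_of_mul hab
      have hb := adj_apply_ne_zero.1 (right_ne_zero_of_mul hab)
      rw [hnd] at ha
      have hal : a.left = g.left := (congrArg Arrow.left heq).trans hgl
      have hbr : b.right = h.left := (congrArg Arrow.right heq).trans hhl
      have har : a.right = g.right := by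
        refine hN _ ⟨a, ⟨left_ne_zero_of_mul ha, hal⟩, rfl⟩ ?_
        exact mem_cylinder_take_iff.1 (unit_mem_bicylinder_self.1
          (mem_of_indicator_ne_zero (right_ne_zero_of_mul ha)))
      have h1 : a.lag ≤ g'.lag := hmax a ⟨left_ne_zero_of_mul ha, hal, har⟩
      have h2 : h'.lag ≤ -b.lag := hmin b.inv ⟨hb, hbr, e.symm.trans har⟩
      have h3 : a.lag + b.lag = g'.lag + -h'.lag := congrArg Arrow.lag heq
      exact hne (Arrow.ext (hal.trans hgl.symm) (by omega) (har.trans hgr.symm))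
  obtain ⟨x, hx⟩ := (mem_diagonal_iff.1 (hd d hdiag)).2 hval
  have hlr : g.left = h.left :=
    hgl.symm.trans ((congrArg Arrow.left hx).symm.trans ((congrArg Arrow.right hx).trans hhl))
  have hlag : (0 : ℤ) = g'.lag + -h'.lag := congrArg Arrow.lag hx
  -- as `r(g) = r(h)`, both lags lie between the smallest and the largest one, which agree
  have e1 := hmax g ⟨hg, rfl, rfl⟩
  have e2 := hmin h ⟨hh, rfl, hgh.symm⟩
  have e3 := hmax h ⟨hh, hlr.symm, hgh.symm⟩
  have e4 := hmin g ⟨hg, hlr, rfl⟩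
  exact Arrow.ext hlr (by omega) hgh

theorem conv_conv_adj_mem_diagonal {n d : Arrow Γ → R} (hn : n ∈ leavitt Γ R)
    (hb : IsBisection (Function.support n)) (hd : d ∈ diagonal Γ R) :
    conv (conv n d) (adj n) ∈ diagonal Γ R := by
  rw [mem_diagonal_iff] at hd ⊢
  refine ⟨conv_mem_leavitt (conv_mem_leavitt hn hd.1) (adj_mem_leavitt hn), ?_⟩
  have hnd := support_conv (g := d) hb.1
  have hnd' := (hb.prod (isBisection_range_unit.subset hd.2)).1
  rw [← hnd] at hnd'
  rw [support_conv hnd', hnd, support_adj]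
  rintro _ ⟨_, ⟨a, ha, b, hb', e, rfl⟩, c, hc, e', rfl⟩
  obtain ⟨x, rfl⟩ := hd.2 hb'
  obtain rfl : a = c.inv := hb.2 ha hc (e.trans e')
  exact ⟨c.right, Arrow.ext rfl (by simp [Arrow.mul, Arrow.unit, Arrow.inv]) rfl⟩

/-- The normalizers are the elements of the Leavitt path algebra whose support is a
bisection. -/
theorem mem_normalizers_iff {n : Arrow Γ → R} :
    n ∈ normalizers Γ R ↔ n ∈ leavitt Γ R ∧ IsBisection (Function.support n) := by
  constructor
  · rintro ⟨hn, h⟩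
    refine ⟨hn, ?_, injOn_right_support hn fun d hd => (h d hd).1⟩
    have := injOn_right_support (adj_mem_leavitt hn) fun d hd => by
      rw [adj_adj]
      exact (h d hd).2
    rw [support_adj] at this
    intro a ha b hb e
    rw [← a.inv_inv, ← b.inv_inv]
    refine congrArg Arrow.inv (@this a.inv ?_ b.inv ?_ e)
    · rwa [mem_preimage, a.inv_inv]
    · rwa [mem_preimage, b.inv_inv]
  · rintro ⟨hn, hb⟩
    refine ⟨hn, fun d hd => ⟨conv_conv_adj_mem_diagonal hn hb hd, ?_⟩⟩
    have := conv_conv_adj_mem_diagonal (adj_mem_leavitt hn) (by rw [support_adj]; exact hb.inv) hd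
    rwa [adj_adj] at this

theorem adj_mem_normalizers {n : Arrow Γ → R} (hn : n ∈ normalizers Γ R) :
    adj n ∈ normalizers Γ R := by
  rw [mem_normalizers_iff] at hn ⊢
  refine ⟨adj_mem_leavitt hn.1, ?_⟩
  rw [support_adj]
  exact hn.2.inv

theorem conv_mem_normalizers {m n : Arrow Γ → R} (hm : m ∈ normalizers Γ R)
    (hn : n ∈ normalizers Γ R) : conv m n ∈ normalizers Γ R := by
  rw [mem_normalizers_iff] at hm hn ⊢
  refine ⟨conv_mem_leavitt hm.1 hn.1, ?_⟩
  rw [support_conv hm.2.1]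
  exact hm.2.prod hn.2

theorem charFun_mem_normalizers {μ ν : FinPath Γ} (h : μ.source = ν.source) :
    charFun R (bicylinder μ ν) ∈ normalizers Γ R := by
  rw [mem_normalizers_iff, support_charFun]
  exact ⟨charFun_mem_leavitt h, isBisection_bicylinder μ ν⟩

theorem diagonal_subset_normalizers {d : Arrow Γ → R} (hd : d ∈ diagonal Γ R) :
    d ∈ normalizers Γ R := by
  rw [mem_diagonal_iff] at hd
  exact mem_normalizers_iff.2 ⟨hd.1, isBisection_range_unit.subset hd.2⟩

theorem conv_ne_zero {m n : Arrow Γ → R} (hm : m ∈ normalizers Γ R) {g h : Arrow Γ}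
    (hg : m g ≠ 0) (hh : n h ≠ 0) (e : g.right = h.left) : conv m n (g.mul h e) ≠ 0 :=
  conv_mul_ne_zero (mem_normalizers_iff.1 hm).2.1 hg hh e

theorem mem_dom_iff {n : Arrow Γ → R} (hn : n ∈ normalizers Γ R) {x : InfPath Γ} :
    x ∈ dom n ↔ ∃ g, n g ≠ 0 ∧ g.right = x := by
  constructor
  · intro hx
    have : Arrow.unit x ∈ Function.support (conv (adj n) n) := hx
    rw [support_conv (mem_normalizers_iff.1 (adj_mem_normalizers hn)).2.1] at this
    obtain ⟨a, -, b, hb, e, hab⟩ := this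
    exact ⟨b, hb, (congrArg Arrow.right hab).symm⟩
  · rintro ⟨g, hg, rfl⟩
    change conv (adj n) n (Arrow.unit g.right) ≠ 0
    rw [← g.inv_mul_self]
    exact conv_ne_zero (adj_mem_normalizers hn) (adj_apply_ne_zero.2 (by rwa [g.inv_inv])) hg rfl

theorem targets_eq {n : Arrow Γ → R} (hn : n ∈ normalizers Γ R) {g : Arrow Γ} (hg : n g ≠ 0) :
    targets n g.right = {g.left} := by
  refine Subset.antisymm ?_ (singleton_subset_iff.2 ⟨g, hg, rfl, rfl⟩)
  rintro _ ⟨h, hh, e, rfl⟩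
  exact congrArg Arrow.left ((mem_normalizers_iff.1 hn).2.2 hh hg e)

theorem alpha_eq {n : Arrow Γ → R} (hn : n ∈ normalizers Γ R) {g : Arrow Γ} (hg : n g ≠ 0) :
    alpha n g.right = g.left := by
  have h : (targets n g.right).Nonempty := ⟨g.left, g, hg, rfl, rfl⟩
  rw [alpha, dif_pos h]
  exact (targets_eq hn hg).subset h.some_mem

end Algebra

/-! ### Transport of groupoid structures -/

section Transport

universe u v

variable {G : Type u} {H : Type v}

/-- The groupoid structure on `H` that corresponds to `S` under a bijection `G ≃ H`. -/
def GroupoidStr.transport (S : GroupoidStr G) (e : G ≃ H) : GroupoidStr H where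
  rng a := e (S.rng (e.symm a))
  src a := e (S.src (e.symm a))
  inv a := e (S.inv (e.symm a))
  mul a b h := e (S.mul (e.symm a) (e.symm b) (e.injective h))
  rng_rng a := by simp [S.rng_rng]
  src_rng a := by simp [S.src_rng]
  rng_src a := by simp [S.rng_src]
  src_src a := by simp [S.src_src]
  rng_mul a b h := by simp [S.rng_mul]
  src_mul a b h := by simp [S.src_mul]
  mul_assoc a b c h₁ h₂ := by
    simp only [e.symm_apply_apply]
    exact congrArg e (S.mul_assoc _ _ _ _ _)
  rng_mul_self a := by simp [S.rng_mul_self]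
  mul_src_self a := by simp [S.mul_src_self]
  rng_inv a := by simp [S.rng_inv]
  src_inv a := by simp [S.src_inv]
  mul_inv a := by simp [S.mul_inv]
  inv_mul a := by simp [S.inv_mul]

/-- The bijection along which a groupoid structure is transported is an isomorphism. -/
def GroupoidStr.transportIso (S : GroupoidStr G) (e : G ≃ H) : GroupoidIso S (S.transport e) where
  toEquiv := e
  map_rng a := congrArg (fun b => e (S.rng b)) (e.symm_apply_apply a).symm
  map_src a := congrArg (fun b => e (S.src b)) (e.symm_apply_apply a).symm
  map_inv a := congrArg (fun b => e (S.inv b)) (e.symm_apply_apply a).symm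
  map_mul a b h := by
    change e (S.mul a b h) = e (S.mul (e.symm (e a)) (e.symm (e b)) _)
    simp only [e.symm_apply_apply]

theorem GroupoidStr.IsTopological.transport [TopologicalSpace G] [TopologicalSpace H]
    {S : GroupoidStr G} (hS : S.IsTopological) (e : G ≃ₜ H) :
    (S.transport e.toEquiv).IsTopological := by
  refine ⟨?_, e.continuous.comp (hS.2.comp e.symm.continuous)⟩
  refine e.continuous.comp (hS.1.comp (f := fun p :
    {p : H × H // (S.transport e.toEquiv).src p.1 = (S.transport e.toEquiv).rng p.2} =>
      (⟨(e.symm p.1.1, e.symm p.1.2), e.injective p.2⟩ : {p : G × G // S.src p.1 = S.rng p.2})) ?_)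
  exact Continuous.subtype_mk ((e.symm.continuous.comp (continuous_fst.comp
    continuous_subtype_val)).prodMk (e.symm.continuous.comp (continuous_snd.comp
    continuous_subtype_val))) _

end Transport

/-! ### The bijection between the Weyl groupoid and the graph groupoid -/

section Weyl

universe u v w

variable {V : Type u} {E : Type v} {Γ : DirectedGraph V E}

theorem isTopological_graphGroupoid : (graphGroupoid Γ).IsTopological := by
  refine ⟨?_, continuous_arrow_inv⟩
  exact continuous_arrow_mul.comp (f := fun p :
    {p : Arrow Γ × Arrow Γ // (graphGroupoid Γ).src p.1 = (graphGroupoid Γ).rng p.2} =>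
      (⟨p.1, Arrow.unit_left_inj p.2⟩ : {p : Arrow Γ × Arrow Γ // p.1.right = p.2.left}))
    (continuous_subtype_val.subtype_mk _)

variable {R : Type w} [CommRing R] [IsDomain R] [StarRing R]

theorem WeylPair.exists_arrow (p : WeylPair Γ R) : ∃ g, p.n g ≠ 0 ∧ g.right = p.x :=
  (mem_dom_iff p.mem_normalizers).1 p.mem_dom

/-- The unique arrow with source `x` at which the normalizer `n` does not vanish. -/
noncomputable def WeylPair.arrow (p : WeylPair Γ R) : Arrow Γ := p.exists_arrow.choose

theorem WeylPair.n_arrow (p : WeylPair Γ R) : p.n p.arrow ≠ 0 := p.exists_arrow.choose_spec.1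

theorem WeylPair.arrow_right (p : WeylPair Γ R) : p.arrow.right = p.x :=
  p.exists_arrow.choose_spec.2

theorem WeylPair.eq_arrow (p : WeylPair Γ R) {g : Arrow Γ} (hg : p.n g ≠ 0)
    (hx : g.right = p.x) : g = p.arrow :=
  (mem_normalizers_iff.1 p.mem_normalizers).2.2 hg p.n_arrow (hx.trans p.arrow_right.symm)

theorem WeylPair.alpha_eq (p : WeylPair Γ R) : alpha p.n p.x = p.arrow.left := by
  rw [← p.arrow_right]
  exact GraphWeyl.alpha_eq p.mem_normalizers p.n_arrow

/-- The pair of a normalizer and the source of an arrow at which it does not vanish. -/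
def WeylPair.ofArrow {n : Arrow Γ → R} (hn : n ∈ normalizers Γ R) {g : Arrow Γ} (hg : n g ≠ 0) :
    WeylPair Γ R :=
  ⟨n, g.right, hn, (mem_dom_iff hn).2 ⟨g, hg, rfl⟩⟩

theorem WeylPair.arrow_ofArrow {n : Arrow Γ → R} (hn : n ∈ normalizers Γ R) {g : Arrow Γ}
    (hg : n g ≠ 0) : (WeylPair.ofArrow hn hg).arrow = g :=
  ((WeylPair.ofArrow hn hg).eq_arrow hg rfl).symm

/-- Over an isolated point, `p_x n^* m p_x` is supported at `g⁻¹ h`, where `g` and `h` are the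
arrows of `n` and `m` over `x`. -/
theorem isHomogeneous_iff {p q : WeylPair Γ R} (hx : p.x = q.x)
    (hα : p.arrow.left = q.arrow.left) :
    IsHomogeneousOfDegree
      (conv (conv (conv (pointFun R p.x) (adj p.n)) q.n) (pointFun R p.x)) 0 ↔
      p.arrow.lag = q.arrow.lag := by
  have hp := (mem_normalizers_iff.1 (adj_mem_normalizers p.mem_normalizers)).2
  have hq := (mem_normalizers_iff.1 q.mem_normalizers).2
  have hs : Function.support (pointFun R p.x) = {Arrow.unit p.x} := support_charFun _
  have h0 : IsBisection (Function.support (pointFun R p.x)) :=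
    isBisection_range_unit.subset (by rw [hs, singleton_subset_iff]; exact ⟨_, rfl⟩)
  have h1 := h0.prod hp
  rw [← support_conv h0.1] at h1
  have h2 := h1.prod hq
  rw [← support_conv h1.1] at h2
  have hu : pointFun R p.x (Arrow.unit p.x) ≠ 0 := by
    rw [← Function.mem_support, hs]
    rfl
  constructor
  · intro h
    have ha : adj p.n p.arrow.inv ≠ 0 :=
      adj_apply_ne_zero.2 (by rw [Arrow.inv_inv]; exact p.n_arrow)
    have m1 : conv (pointFun R p.x) (adj p.n)
        ((Arrow.unit p.x).mul p.arrow.inv p.arrow_right.symm) ≠ 0 :=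
      conv_mul_ne_zero h0.1 hu ha _
    have m2 : conv (conv (pointFun R p.x) (adj p.n)) q.n
        (((Arrow.unit p.x).mul p.arrow.inv p.arrow_right.symm).mul q.arrow hα) ≠ 0 :=
      conv_mul_ne_zero h1.1 m1 q.n_arrow _
    have m3 : conv (conv (conv (pointFun R p.x) (adj p.n)) q.n) (pointFun R p.x)
        ((((Arrow.unit p.x).mul p.arrow.inv p.arrow_right.symm).mul q.arrow hα).mul
          (Arrow.unit p.x) (q.arrow_right.trans hx.symm)) ≠ 0 :=
      conv_mul_ne_zero h2.1 m2 hu _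
    have : 0 + -p.arrow.lag + q.arrow.lag + 0 = 0 := h _ m3
    omega
  · intro h k hk
    rw [← Function.mem_support, support_conv h2.1, support_conv h1.1, support_conv h0.1, hs,
      support_adj] at hk
    obtain ⟨_, ⟨_, ⟨_, rfl, a, ha, e1, rfl⟩, b, hb, e2, rfl⟩, _, rfl, e3, rfl⟩ := hk
    have hb' : b = q.arrow := q.eq_arrow hb (e3.trans hx)
    have ha' : a.inv = p.arrow := p.eq_arrow ha e1.symm
    change 0 + a.lag + b.lag + 0 = 0
    have : -a.lag = p.arrow.lag := congrArg Arrow.lag ha'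
    rw [hb']
    omega

/-- If two arrows have equal sources and ranges but different lags, and the partial actions of
two normalizers that do not vanish at them agree near the source, then the paths near the source
are periodic, so the source is isolated. -/
theorem isIsolated_of_lag_lt {p q : WeylPair Γ R} (hx : p.x = q.x)
    (hlt : p.arrow.lag < q.arrow.lag) {U : Set (InfPath Γ)} (hU : IsOpen U) (hxU : p.x ∈ U)
    (h : ∀ y ∈ U, alpha p.n y = alpha q.n y) : IsIsolated p.x := by
  obtain ⟨N, hN⟩ := Arrow.exists_nhd_subset
    (isOpen_support_of_mem_leavitt (mem_normalizers_iff.1 p.mem_normalizers).1) p.n_arrow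
  obtain ⟨M, hM⟩ := Arrow.exists_nhd_subset
    (isOpen_support_of_mem_leavitt (mem_normalizers_iff.1 q.mem_normalizers).1) q.n_arrow
  obtain ⟨a, b, ha, -, hp⟩ := p.arrow.exists_hasLegs_ge N
  obtain ⟨c, d, hc, -, hq⟩ := q.arrow.exists_hasLegs_ge M
  -- lengthen the legs so that the two legs along `x` have a common length
  have hp' := hp.add d
  have hq' := hq.add b
  rw [Nat.add_comm d b] at hq'
  have hpN := hN _ _ (by omega) hp'
  have hqM := hM _ _ (by omega) hq'
  have e1 := hp'.1
  have e2 := hq'.1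
  refine isIsolated_of_periodic (b := b + d) (p := c + b - (a + d))
    ((hU.inter (isOpen_cylinder (p.arrow.right.take (b + d)))))
    ⟨hxU, ?_⟩ (by omega) ?_
  · rw [p.arrow_right]
    exact mem_cylinder_take _ _
  · rintro y ⟨hyU, hy⟩ i
    obtain ⟨k, hk, hky⟩ := exists_right_eq_of_mem_cylinder hp' hy
    rw [p.arrow_right, hx, ← q.arrow_right] at hy
    obtain ⟨l, hl, hly⟩ := exists_right_eq_of_mem_cylinder hq' hy
    have hkl : k.left = l.left := by
      rw [← alpha_eq p.mem_normalizers (hpN hk), ← alpha_eq q.mem_normalizers (hqM hl), hky, hly,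
        h y hyU]
    have k1 : ∀ j, k.left.edge (a + d + j) = y.edge (b + d + j) := fun j =>
      hky ▸ congrFun (congrArg InfPath.edge (Arrow.mem_nhd_iff.1 hk).2.2.2) j
    have l1 : ∀ j, l.left.edge (c + b + j) = y.edge (b + d + j) := fun j =>
      hly ▸ congrFun (congrArg InfPath.edge (Arrow.mem_nhd_iff.1 hl).2.2.2) j
    -- with `z = k.left = l.left`: `y_{b+d+i} = z_{c+b+i} = y_{b+d+(c+b-(a+d))+i}`
    rw [← l1 i, ← hkl, add_assoc, ← k1]
    congr 1
    omega

/-- Two pairs are equivalent if and only if they determine the same arrow of the graph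
groupoid. -/
theorem weylRel_iff {p q : WeylPair Γ R} : WeylRel p q ↔ p.arrow = q.arrow := by
  constructor
  · rintro ⟨hx, ⟨-, hα, hd⟩ | ⟨hiso, U, hU, hxU, -, hα⟩⟩
    · rw [p.alpha_eq, hx, q.alpha_eq] at hα
      exact Arrow.ext hα ((isHomogeneous_iff hx hα).1 hd)
        (p.arrow_right.trans (hx.trans q.arrow_right.symm))
    · have hα' := hα _ hxU
      rw [p.alpha_eq, hx, q.alpha_eq] at hα'
      refine Arrow.ext hα' ?_ (p.arrow_right.trans (hx.trans q.arrow_right.symm))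
      rcases lt_trichotomy p.arrow.lag q.arrow.lag with h | h | h
      · exact (hiso (isIsolated_of_lag_lt hx h hU hxU hα)).elim
      · exact h
      · rw [hx] at hiso hxU
        exact (hiso (isIsolated_of_lag_lt hx.symm h hU hxU fun y hy => (hα y hy).symm)).elim
  · intro h
    have hx : p.x = q.x := by rw [← p.arrow_right, ← q.arrow_right, h]
    refine ⟨hx, ?_⟩
    by_cases hiso : IsIsolated p.x
    · left
      refine ⟨hiso, ?_, (isHomogeneous_iff hx (by rw [h])).2 (by rw [h])⟩
      rw [p.alpha_eq, hx, q.alpha_eq, h]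
    · right
      refine ⟨hiso, ?_⟩
      have ho := (isOpen_support_of_mem_leavitt (mem_normalizers_iff.1 p.mem_normalizers).1).inter
        (isOpen_support_of_mem_leavitt (mem_normalizers_iff.1 q.mem_normalizers).1)
      obtain ⟨N, hN⟩ := Arrow.exists_nhd_subset ho ⟨p.n_arrow, h ▸ q.n_arrow⟩
      obtain ⟨a, b, ha, -, hl⟩ := p.arrow.exists_hasLegs_ge N
      have hs := hN a b ha hl
      refine ⟨cylinder (p.arrow.right.take b), isOpen_cylinder _, ?_, ?_, ?_⟩
      · rw [p.arrow_right]
        exact mem_cylinder_take _ _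
      · intro y hy
        obtain ⟨k, hk, rfl⟩ := exists_right_eq_of_mem_cylinder hl hy
        exact ⟨(mem_dom_iff p.mem_normalizers).2 ⟨k, (hs hk).1, rfl⟩,
          (mem_dom_iff q.mem_normalizers).2 ⟨k, (hs hk).2, rfl⟩⟩
      · intro y hy
        obtain ⟨k, hk, rfl⟩ := exists_right_eq_of_mem_cylinder hl hy
        rw [alpha_eq p.mem_normalizers (hs hk).1, alpha_eq q.mem_normalizers (hs hk).2]

/-- The supports of normalizers are a neighbourhood basis at every arrow. -/
theorem exists_normalizer_subset {U : Set (Arrow Γ)} (hU : IsOpen U) {g : Arrow Γ} (hg : g ∈ U) :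
    ∃ n ∈ normalizers Γ R, n g ≠ 0 ∧ Function.support n ⊆ U := by
  obtain ⟨N, hN⟩ := Arrow.exists_nhd_subset hU hg
  obtain ⟨a, b, ha, -, hl⟩ := g.exists_hasLegs_ge N
  have hs := support_charFun (R := R) (g.nhd a b)
  refine ⟨charFun R (g.nhd a b), charFun_mem_normalizers hl.source_eq, ?_, ?_⟩
  · rw [← Function.mem_support, hs]
    exact hl.mem_nhd
  · rw [hs]
    exact hN a b ha hl

variable (Γ R) in
/-- The bijection that sends `[(n, x)]` to the arrow of `n` over `x`. -/
noncomputable def weylEquiv : Weyl Γ R ≃ Arrow Γ :=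
  Equiv.ofBijective (Quot.lift WeylPair.arrow fun _ _ h => weylRel_iff.1 h) <| by
    constructor
    · rintro ⟨p⟩ ⟨q⟩ h
      exact Quot.sound (weylRel_iff.2 h)
    · intro g
      obtain ⟨n, hn, hg, -⟩ := exists_normalizer_subset (R := R) isOpen_univ (mem_univ g)
      exact ⟨(WeylPair.ofArrow hn hg).cls, WeylPair.arrow_ofArrow hn hg⟩

theorem isClassOf_iff {c : Weyl Γ R} {n : Arrow Γ → R} {x : InfPath Γ} :
    IsClassOf c n x ↔
      n ∈ normalizers Γ R ∧ n (weylEquiv Γ R c) ≠ 0 ∧ (weylEquiv Γ R c).right = x := by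
  constructor
  · rintro ⟨p, rfl, rfl, rfl⟩
    exact ⟨p.mem_normalizers, p.n_arrow, p.arrow_right⟩
  · rintro ⟨hn, hc, rfl⟩
    refine ⟨WeylPair.ofArrow hn hc, rfl, rfl, (weylEquiv Γ R).injective ?_⟩
    exact (WeylPair.arrow_ofArrow hn hc).symm

theorem isClassOf_symm_iff {g : Arrow Γ} {n : Arrow Γ → R} {x : InfPath Γ} :
    IsClassOf ((weylEquiv Γ R).symm g) n x ↔ n ∈ normalizers Γ R ∧ n g ≠ 0 ∧ g.right = x := by
  rw [isClassOf_iff, Equiv.apply_symm_apply]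

/-- The bijection carries the set `Z(n)` to the support of `n`. -/
theorem weylBasic_eq {n : Arrow Γ → R} (hn : n ∈ normalizers Γ R) :
    weylBasic n = weylEquiv Γ R ⁻¹' Function.support n := by
  ext c
  constructor
  · rintro ⟨x, -, hc⟩
    exact (isClassOf_iff.1 hc).2.1
  · intro hc
    exact ⟨_, (mem_dom_iff hn).2 ⟨_, hc, rfl⟩, isClassOf_iff.2 ⟨hn, hc, rfl⟩⟩

/-! ### The topology of the Weyl groupoid -/

theorem isOpen_support {n : Arrow Γ → R} (hn : n ∈ normalizers Γ R) :
    IsOpen (Function.support n) :=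
  isOpen_support_of_mem_leavitt (mem_normalizers_iff.1 hn).1

theorem continuous_weylEquiv : Continuous (weylEquiv Γ R) := by
  rw [continuous_def]
  intro U hU
  rw [isOpen_iff_forall_mem_open]
  intro c hc
  obtain ⟨n, hn, hg, hs⟩ := exists_normalizer_subset (R := R) hU hc
  refine ⟨weylBasic n, ?_, isOpen_generateFrom_of_mem ⟨n, hn, rfl⟩, ?_⟩
  · rw [weylBasic_eq hn]
    exact preimage_mono hs
  · rw [weylBasic_eq hn]
    exact hg

theorem continuous_weylEquiv_symm : Continuous (weylEquiv Γ R).symm := by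
  refine continuous_generateFrom_iff.2 ?_
  rintro _ ⟨n, hn, rfl⟩
  rw [weylBasic_eq hn, ← preimage_comp, Equiv.self_comp_symm, preimage_id]
  exact isOpen_support hn

variable (Γ R) in
/-- The topological form of `weylEquiv`. -/
noncomputable def weylHomeomorph : Weyl Γ R ≃ₜ Arrow Γ where
  toEquiv := weylEquiv Γ R
  continuous_toFun := continuous_weylEquiv
  continuous_invFun := continuous_weylEquiv_symm

theorem isTopologicalBasis_weylBasis : IsTopologicalBasis (weylBasis Γ R) := by
  refine isTopologicalBasis_of_isOpen_of_nhds ?_ ?_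
  · exact fun B hB => isOpen_generateFrom_of_mem hB
  · intro c U hc hU
    have hU' : IsOpen ((weylEquiv Γ R).symm ⁻¹' U) := hU.preimage continuous_weylEquiv_symm
    obtain ⟨n, hn, hg, hs⟩ := exists_normalizer_subset (R := R) (g := weylEquiv Γ R c) hU'
      (by rwa [mem_preimage, Equiv.symm_apply_apply])
    refine ⟨_, ⟨n, hn, rfl⟩, ?_, ?_⟩
    · rw [weylBasic_eq hn]
      exact hg
    · rw [weylBasic_eq hn]
      intro d hd
      have := hs hd
      rwa [mem_preimage, Equiv.symm_apply_apply] at this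

/-! ### The groupoid structure on the set of classes -/

variable (Γ R) in
/-- The groupoid structure of the graph groupoid, transported to the set of classes. -/
noncomputable def weylGroupoid : GroupoidStr (Weyl Γ R) :=
  (graphGroupoid Γ).transport (weylEquiv Γ R).symm

theorem isWeylStructure_weylGroupoid : IsWeylStructure (weylGroupoid Γ R) where
  composable p q := by
    change (weylEquiv Γ R).symm (Arrow.unit p.arrow.right) =
      (weylEquiv Γ R).symm (Arrow.unit q.arrow.left) ↔ _
    rw [(weylEquiv Γ R).symm.injective.eq_iff, q.alpha_eq, p.arrow_right]
    exact ⟨fun h => (Arrow.unit_left_inj h).symm, fun h => congrArg Arrow.unit h.symm⟩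
  mul p q h := by
    have e : p.arrow.right = q.arrow.left :=
      Arrow.unit_left_inj ((weylEquiv Γ R).symm.injective h)
    change IsClassOf ((weylEquiv Γ R).symm (p.arrow.mul q.arrow e)) _ _
    exact isClassOf_symm_iff.2 ⟨conv_mem_normalizers p.mem_normalizers q.mem_normalizers,
      conv_ne_zero p.mem_normalizers p.n_arrow q.n_arrow e, q.arrow_right⟩
  rng p := by
    change IsClassOf ((weylEquiv Γ R).symm (Arrow.unit p.arrow.left)) _ _
    refine isClassOf_symm_iff.2 ⟨conv_mem_normalizers p.mem_normalizers
      (adj_mem_normalizers p.mem_normalizers), ?_, p.alpha_eq.symm⟩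
    rw [← p.arrow.mul_inv_self]
    exact conv_ne_zero p.mem_normalizers p.n_arrow
      (adj_apply_ne_zero.2 (by rw [Arrow.inv_inv]; exact p.n_arrow)) rfl
  src p := by
    change IsClassOf ((weylEquiv Γ R).symm (Arrow.unit p.arrow.right)) _ _
    refine isClassOf_symm_iff.2 ⟨conv_mem_normalizers (adj_mem_normalizers p.mem_normalizers)
      p.mem_normalizers, ?_, p.arrow_right⟩
    rw [← p.arrow.inv_mul_self]
    exact conv_ne_zero (adj_mem_normalizers p.mem_normalizers)
      (adj_apply_ne_zero.2 (by rw [Arrow.inv_inv]; exact p.n_arrow)) p.n_arrow rfl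
  inv p := by
    change IsClassOf ((weylEquiv Γ R).symm p.arrow.inv) _ _
    exact isClassOf_symm_iff.2 ⟨adj_mem_normalizers p.mem_normalizers,
      adj_apply_ne_zero.2 (by rw [Arrow.inv_inv]; exact p.n_arrow), p.alpha_eq.symm⟩
  units := by
    ext c
    obtain ⟨g, rfl⟩ := (weylEquiv Γ R).symm.surjective c
    have hrng : (weylGroupoid Γ R).rng ((weylEquiv Γ R).symm g) =
        (weylEquiv Γ R).symm (Arrow.unit g.left) := by
      change (weylEquiv Γ R).symm (Arrow.unit ((weylEquiv Γ R) ((weylEquiv Γ R).symm g)).left) = _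
      rw [Equiv.apply_symm_apply]
    change (weylGroupoid Γ R).rng _ = _ ↔ _
    rw [hrng, (weylEquiv Γ R).symm.injective.eq_iff]
    constructor
    · intro hg
      have hd : charFun R (bicylinder (g.left.take 0) (g.left.take 0)) ∈ diagonal Γ R :=
        Submodule.subset_span ⟨_, rfl⟩
      have hne : charFun R (bicylinder (g.left.take 0) (g.left.take 0)) g ≠ 0 := by
        rw [← Function.mem_support, support_charFun, ← hg]
        exact unit_mem_bicylinder_self.2 (mem_cylinder_take _ _)
      have hn := diagonal_subset_normalizers hd
      exact ⟨_, hd, _, (mem_dom_iff hn).2 ⟨g, hne, rfl⟩, isClassOf_symm_iff.2 ⟨hn, hne, rfl⟩⟩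
    · rintro ⟨d, hd, x, -, hc⟩
      obtain ⟨y, rfl⟩ := (mem_diagonal_iff.1 hd).2 (isClassOf_symm_iff.1 hc).2.1
      rfl

end Weyl

end GraphWeyl

theorem theorem3 {V : Type*} {E : Type*} (Γ : DirectedGraph V E)
    (hfin : RowFinite Γ) (hns : NoSources Γ)
    (R : Type*) [CommRing R] [IsDomain R] [StarRing R] :
    -- the partial action and the set of classes are well defined
    (∀ n ∈ normalizers Γ R, ∀ x ∈ dom n, targets n x = {alpha n x}) ∧
    Equivalence (WeylRel (Γ := Γ) (R := R)) ∧
    -- the sets `Z(n)` are a basis of the topology they generate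
    TopologicalSpace.IsTopologicalBasis (weylBasis Γ R) ∧
    -- the Weyl groupoid is a topological groupoid, isomorphic to the graph groupoid through `Φ`
    ∃ W : GroupoidStr (Weyl Γ R), IsWeylStructure W ∧ W.IsTopological ∧
      ∃ Φ : GroupoidIso (graphGroupoid Γ) W,
        (∀ (μ ν : FinPath Γ) (z : InfPath Γ) (hμ : μ.source = z.range) (hν : ν.source = z.range),
          IsClassOf (Φ.toEquiv (arrowOf μ ν z hμ hν)) (charFun R (bicylinder μ ν))
            (concat ν z hν)) ∧
        Continuous Φ.toEquiv ∧ Continuous Φ.toEquiv.symm := by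
  refine ⟨?_, ?_, isTopologicalBasis_weylBasis, weylGroupoid Γ R, isWeylStructure_weylGroupoid,
    isTopological_graphGroupoid.transport (weylHomeomorph Γ R).symm,
    (graphGroupoid Γ).transportIso (weylEquiv Γ R).symm, ?_, continuous_weylEquiv_symm,
    continuous_weylEquiv⟩
  · intro n hn x hx
    obtain ⟨g, hg, rfl⟩ := (mem_dom_iff hn).1 hx
    rw [targets_eq hn hg, alpha_eq hn hg]
  · exact ⟨fun p => weylRel_iff.2 rfl, fun h => weylRel_iff.2 (weylRel_iff.1 h).symm,
      fun h h' => weylRel_iff.2 ((weylRel_iff.1 h).trans (weylRel_iff.1 h'))⟩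
  · intro μ ν z hμ hν
    refine isClassOf_symm_iff.2 ⟨charFun_mem_normalizers (hμ.trans hν.symm), ?_, rfl⟩
    rw [← Function.mem_support, support_charFun]
    exact ⟨z, hμ, hν, rfl⟩
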